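/- Let $K$ be a field; all spaces and tensor products are over $K$, and Sweedler notation is used. **Definitions.** A *Hom-algebra* $(A,\mu,1_A,\alpha)$ is a space $A$ with a linear map $\mu:A\otimes A\to A$, an element $1_A$ and a linear automorphism $\alpha$ such that $\alpha(ab)=\alpha(a)\alpha(b)$, $\alpha(1_A)=1_A$, $\alpha(a)(bc)=(ab)\alpha(c)$ and $a1_A=1_Aa=\alpha(a)$. A *Hom-coalgebra* $(C,\Delta,\varepsilon,\alpha)$ satisfies $\Delta(\alpha(c))=\alpha(c_1)\otimes\alpha(c_2)$, $\varepsilon\circ\alpha=\varepsilon$, $\alpha(c_1)\otimes c_{21}\otimes c_{22}=c_{11}\otimes c_{12}\otimes\alpha(c_2)$ and $\varepsilon(c_1)c_2=c_1\varepsilon(c_2)=\alpha(c)$, with $\alpha$ a linear automorphism. A *Hom-bialgebra* is a Hom-algebra and a Hom-coalgebra with the same automorphism such that $\Delta$ and $\varepsilon$ are multiplicative and unital. A *Hom-Hopf algebra* $(H,\beta)$ is a Hom-bialgebra with a linear map $S:H\to H$ (the antipode) such that $S(h_1)h_2=h_1S(h_2)=\varepsilon(h)1_H$ and $S\circ\beta=\beta\circ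 S$. Let $(H,\beta)$ be a Hom-bialgebra. A *left $(H,\beta)$-Hom-module* $(M,\rhd,\alpha)$ satisfies $\alpha(h\rhd m)=\beta(h)\rhd\alpha(m)$, $\beta(g)\rhd(h\rhd m)=(gh)\rhd\alpha(m)$ and $1_H\rhd m=\alpha(m)$. A *left $(H,\beta)$-Hom-comodule* $(M,\rho,\alpha)$, $\rho(m)=m_{-1}\otimes m_0\in H\otimes M$, satisfies $\rho(\alpha(m))=\beta(m_{-1})\otimes\alpha(m_0)$, $\beta(m_{-1})\otimes\rho(m_0)=\Delta(m_{-1})\otimes\alpha(m_0)$ and $\varepsilon(m_{-1})m_0=\alpha(m)$. Here $\alpha$ is a linear automorphism of $M$. A Hom-algebra $(A,\alpha)$ with a left Hom-module structure $(A,\rhd,\alpha)$ is a *left $(H,\beta)$-module Hom-algebra* if $\beta^2(h)\rhd(ab)=(h_1\rhd a)(h_2\rhd b)$ and $h\rhd1_A=\varepsilon_H(h)1_A$. A Hom-coalgebra $(A,\alpha)$ with a left Hom-comodule structure $(A,\rho,\alpha)$ is a *left $(H,\beta)$-comodule Hom-coalgebra* if $\beta^2(c_{-1})\otimes c_{01}\otimes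 c_{02}=c_{1\,-1}c_{2\,-1}\otimes c_{10}\otimes c_{20}$ and $c_{-1}\varepsilon_A(c_0)=\varepsilon_A(c)1_H$. A *Hom-Yetter–Drinfeld module* over $(H,\beta)$ is a left Hom-module and left Hom-comodule $(M,\rhd,\rho,\alpha)$ with $$h_1\beta(m_{-1})\otimes(\beta^3(h_2)\rhd m_0)=(\beta^2(h_1)\rhd m)_{-1}h_2\otimes(\beta^2(h_1)\rhd m)_0 .$$ These are the objects of the category ${}^H_H\mathbb{YD}$; its morphisms are the linear maps commuting with the actions, the coactions and the automorphisms. The tensor product $M\otimes N$ has action $h\rhd(m\otimes n)=(h_1\rhd m)\otimes(h_2\rhd n)$, coaction $m\otimes n\mapsto\beta^{-2}(m_{-1}n_{-1})\otimes m_0\otimes n_0$ and automorphism $\alpha_M\otimes\alpha_N$; the unit object is $(K,\mathrm{id})$ with $h\rhd k=\varepsilon_H(h)k$, $\rho(k)=1_H\otimes k$; the braiding is $c_{M,N}(m\otimes n)=(\beta^2(m_{-1})\rhd\alpha_N^{-1}(n))\otimes\alpha_M^{-1}(m_0)$. A *bialgebra in* ${}^H_H\mathbb{YD}$ (in the Hom-sense)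 is an object $(A,\rhd,\rho,\alpha)$ of ${}^H_H\mathbb{YD}$ with a Hom-algebra structure $(A,\mu_A,1_A,\alpha)$ and a Hom-coalgebra structure $(A,\Delta_A,\varepsilon_A,\alpha)$ such that $\mu_A:A\otimes A\to A$, the unit $K\to A$, $\Delta_A:A\to A\otimes A$ and $\varepsilon_A:A\to K$ are morphisms of ${}^H_H\mathbb{YD}$, such that $\varepsilon_A(ab)=\varepsilon_A(a)\varepsilon_A(b)$, $\varepsilon_A(1_A)=1$, $\Delta_A(1_A)=1_A\otimes1_A$, and $$\Delta_A\circ\mu_A=(\mu_A\otimes\mu_A)\circ(\mathrm{id}\otimes c_{A,A}\otimes\mathrm{id})\circ(\Delta_A\otimes\Delta_A).$$ **Theorem 4.8.** Let $(H,\beta)$ be a Hom-Hopf algebra with bijective antipode such that $\beta^2=\mathrm{id}_H$, and let $(A,\alpha)$ be a left $(H,\beta)$-module Hom-algebra and a left $(H,\beta)$-comodule Hom-coalgebra. Then the space $A\otimes H$ with multiplication $$(a\otimes h)(a'\otimes h')=a(h_1\rhd\alpha^{-1}(a'))\otimes\beta^{-1}(h_2)h',$$ unit $1_A\otimes1_H$,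 comultiplication $$\Delta(a\otimes h)=(a_1\otimes a_{2\,-1}\beta^{-1}(h_1))\otimes(\alpha^{-1}(a_{20})\otimes h_2),$$ counit $\varepsilon_A\otimes\varepsilon_H$ and automorphism $\alpha\otimes\beta$ is a Hom-bialgebra (the Radford biproduct Hom-bialgebra $(A^\natural_\diamond H,\alpha\otimes\beta)$) if and only if $(A,\alpha)$, with the given action, coaction, Hom-algebra and Hom-coalgebra structures, is a bialgebra in ${}^H_H\mathbb{YD}$. -/

import Mathlib

open scoped TensorProduct

namespace HomBiproduct

section

variable {K : Type*} [Field K]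
variable {H : Type*} [AddCommGroup H] [Module K H]
variable {A : Type*} [AddCommGroup A] [Module K A]
variable {M : Type*} [AddCommGroup M] [Module K M]
variable {N : Type*} [AddCommGroup N] [Module K N]
variable {P : Type*} [AddCommGroup P] [Module K P]
variable {Q : Type*} [AddCommGroup Q] [Module K Q]
variable {P' : Type*} [AddCommGroup P'] [Module K P']
variable {N' : Type*} [AddCommGroup N'] [Module K N']

/-- A Hom-algebra `(A, μ, 1, α)`: the structure map `α` is a linear automorphism, and `μ` is
unital and associative up to `α`. -/
structure IsHomAlgebra (α : A ≃ₗ[K] A) (mul : A ⊗[K] A →ₗ[K] A) (one : A) : Prop where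
  map_mul : ∀ a b : A, α (mul (a ⊗ₜ b)) = mul (α a ⊗ₜ α b)
  map_one : α one = one
  hom_assoc : ∀ a b c : A, mul (α a ⊗ₜ mul (b ⊗ₜ c)) = mul (mul (a ⊗ₜ b) ⊗ₜ α c)
  mul_one : ∀ a : A, mul (a ⊗ₜ one) = α a
  one_mul : ∀ a : A, mul (one ⊗ₜ a) = α a

/-- A Hom-coalgebra `(C, Δ, ε, α)`:
`Δ(α(c)) = α(c₁) ⊗ α(c₂)`, `ε ∘ α = ε`, `α(c₁) ⊗ c₂₁ ⊗ c₂₂ = c₁₁ ⊗ c₁₂ ⊗ α(c₂)` and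
`ε(c₁) c₂ = c₁ ε(c₂) = α(c)`. -/
structure IsHomCoalgebra (α : A ≃ₗ[K] A) (comul : A →ₗ[K] A ⊗[K] A) (counit : A →ₗ[K] K) :
    Prop where
  comul_map : ∀ c : A, comul (α c) = TensorProduct.map α.toLinearMap α.toLinearMap (comul c)
  counit_map : ∀ c : A, counit (α c) = counit c
  hom_coassoc : ∀ c : A,
    TensorProduct.map α.toLinearMap comul (comul c) =
      TensorProduct.assoc K A A A (TensorProduct.map comul α.toLinearMap (comul c))
  counit_left : ∀ c : A, TensorProduct.lid K A (counit.rTensor A (comul c)) = α c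
  counit_right : ∀ c : A, TensorProduct.rid K A (counit.lTensor A (comul c)) = α c

/-- The multiplication `(a ⊗ b)(a' ⊗ b') = aa' ⊗ bb'` on a tensor product. -/
noncomputable def tensorMul (mulM : M ⊗[K] M →ₗ[K] M) (mulN : N ⊗[K] N →ₗ[K] N) :
    (M ⊗[K] N) ⊗[K] (M ⊗[K] N) →ₗ[K] M ⊗[K] N :=
  TensorProduct.map mulM mulN ∘ₗ (TensorProduct.tensorTensorTensorComm K M N M N).toLinearMap

/-- A Hom-bialgebra `(H, μ, 1, Δ, ε, β)`. -/
structure IsHomBialgebra (β : H ≃ₗ[K] H) (mul : H ⊗[K] H →ₗ[K] H) (one : H)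
    (comul : H →ₗ[K] H ⊗[K] H) (counit : H →ₗ[K] K) : Prop where
  algebra : IsHomAlgebra β mul one
  coalgebra : IsHomCoalgebra β comul counit
  comul_mul : ∀ g h : H, comul (mul (g ⊗ₜ h)) = tensorMul mul mul (comul g ⊗ₜ comul h)
  comul_one : comul one = one ⊗ₜ one
  counit_mul : ∀ g h : H, counit (mul (g ⊗ₜ h)) = counit g * counit h
  counit_one : counit one = 1

/-- A Hom-Hopf algebra `(H, μ, 1, Δ, ε, β, S)`: a Hom-bialgebra with a linear map `S` such that
`S(h₁)h₂ = h₁S(h₂) = ε(h)1` and `S ∘ β = β ∘ S`. -/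
structure IsHomHopfAlgebra (β : H ≃ₗ[K] H) (mul : H ⊗[K] H →ₗ[K] H) (one : H)
    (comul : H →ₗ[K] H ⊗[K] H) (counit : H →ₗ[K] K) (S : H →ₗ[K] H) : Prop where
  bialgebra : IsHomBialgebra β mul one comul counit
  antipode_left : ∀ h : H, mul (S.rTensor H (comul h)) = counit h • one
  antipode_right : ∀ h : H, mul (S.lTensor H (comul h)) = counit h • one
  antipode_map : ∀ h : H, S (β h) = β (S h)

/-- A left Hom-module `(M, ▷, α)` over the Hom-algebra `(H, μ, 1, β)`. -/
structure IsHomModule (β : H ≃ₗ[K] H) (mul : H ⊗[K] H →ₗ[K] H) (one : H)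
    (α : M ≃ₗ[K] M) (act : H ⊗[K] M →ₗ[K] M) : Prop where
  map_act : ∀ (h : H) (m : M), α (act (h ⊗ₜ m)) = act (β h ⊗ₜ α m)
  act_act : ∀ (g h : H) (m : M), act (β g ⊗ₜ act (h ⊗ₜ m)) = act (mul (g ⊗ₜ h) ⊗ₜ α m)
  one_act : ∀ m : M, act (one ⊗ₜ m) = α m

/-- A left Hom-comodule `(M, ρ, α)` over the Hom-coalgebra `(H, Δ, ε, β)`, `ρ(m) = m₋₁ ⊗ m₀`:
`ρ(α(m)) = β(m₋₁) ⊗ α(m₀)`, `β(m₋₁) ⊗ ρ(m₀) = Δ(m₋₁) ⊗ α(m₀)` and `ε(m₋₁) m₀ = α(m)`. -/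
structure IsHomComodule (β : H ≃ₗ[K] H) (comul : H →ₗ[K] H ⊗[K] H) (counit : H →ₗ[K] K)
    (α : M ≃ₗ[K] M) (coact : M →ₗ[K] H ⊗[K] M) : Prop where
  coact_map : ∀ m : M, coact (α m) = TensorProduct.map β.toLinearMap α.toLinearMap (coact m)
  coact_coact : ∀ m : M,
    TensorProduct.map β.toLinearMap coact (coact m) =
      TensorProduct.assoc K H H M (TensorProduct.map comul α.toLinearMap (coact m))
  counit_coact : ∀ m : M, TensorProduct.lid K M (counit.rTensor M (coact m)) = α m

/-- The diagonal action `h ▷ (m ⊗ n) = (h₁ ▷ m) ⊗ (h₂ ▷ n)`. -/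
noncomputable def tensorAct (comul : H →ₗ[K] H ⊗[K] H)
    (actM : H ⊗[K] M →ₗ[K] M) (actN : H ⊗[K] N →ₗ[K] N) :
    H ⊗[K] (M ⊗[K] N) →ₗ[K] M ⊗[K] N :=
  TensorProduct.map actM actN ∘ₗ
    (TensorProduct.tensorTensorTensorComm K H H M N).toLinearMap ∘ₗ
      comul.rTensor (M ⊗[K] N)

/-- The map `m ⊗ n ↦ m₋₁n₋₁ ⊗ (m₀ ⊗ n₀)`. -/
noncomputable def codiagonal (mul : H ⊗[K] H →ₗ[K] H)
    (coactM : M →ₗ[K] H ⊗[K] M) (coactN : N →ₗ[K] H ⊗[K] N) :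
    M ⊗[K] N →ₗ[K] H ⊗[K] (M ⊗[K] N) :=
  mul.rTensor (M ⊗[K] N) ∘ₗ
    (TensorProduct.tensorTensorTensorComm K H M H N).toLinearMap ∘ₗ
      TensorProduct.map coactM coactN

/-- The coaction `m ⊗ n ↦ β⁻²(m₋₁n₋₁) ⊗ (m₀ ⊗ n₀)` on a tensor product of Hom-comodules. -/
noncomputable def tensorCoact (β : H ≃ₗ[K] H) (mul : H ⊗[K] H →ₗ[K] H)
    (coactM : M →ₗ[K] H ⊗[K] M) (coactN : N →ₗ[K] H ⊗[K] N) :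
    M ⊗[K] N →ₗ[K] H ⊗[K] (M ⊗[K] N) :=
  (β ^ 2).symm.toLinearMap.rTensor (M ⊗[K] N) ∘ₗ codiagonal mul coactM coactN

/-- `(A, ▷, α)` is a left module Hom-algebra over the Hom-bialgebra `(H, μ, 1, Δ, ε, β)`:
`(A, μ_A, 1_A, α)` is a Hom-algebra, `(A, ▷, α)` is a left Hom-module,
`β²(h) ▷ (ab) = (h₁ ▷ a)(h₂ ▷ b)` and `h ▷ 1_A = ε(h) 1_A`. -/
structure IsModuleHomAlgebra (β : H ≃ₗ[K] H) (mul : H ⊗[K] H →ₗ[K] H) (one : H)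
    (comul : H →ₗ[K] H ⊗[K] H) (counit : H →ₗ[K] K)
    (α : A ≃ₗ[K] A) (mulA : A ⊗[K] A →ₗ[K] A) (oneA : A) (act : H ⊗[K] A →ₗ[K] A) : Prop where
  algebra : IsHomAlgebra α mulA oneA
  module : IsHomModule β mul one α act
  act_mul : ∀ (h : H) (a b : A),
    act ((β ^ 2) h ⊗ₜ mulA (a ⊗ₜ b)) = mulA (tensorAct comul act act (h ⊗ₜ (a ⊗ₜ b)))
  act_one : ∀ h : H, act (h ⊗ₜ oneA) = counit h • oneA

/-- `(A, ρ, α)` is a left comodule Hom-coalgebra over the Hom-bialgebra `(H, μ, 1, Δ, ε, β)`: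
`(A, Δ_A, ε_A, α)` is a Hom-coalgebra, `(A, ρ, α)` is a left Hom-comodule,
`β²(c₋₁) ⊗ c₀₁ ⊗ c₀₂ = c₁₋₁c₂₋₁ ⊗ c₁₀ ⊗ c₂₀` and `c₋₁ ε_A(c₀) = ε_A(c) 1_H`. -/
structure IsComoduleHomCoalgebra (β : H ≃ₗ[K] H) (mul : H ⊗[K] H →ₗ[K] H) (one : H)
    (comul : H →ₗ[K] H ⊗[K] H) (counit : H →ₗ[K] K)
    (α : A ≃ₗ[K] A) (comulA : A →ₗ[K] A ⊗[K] A) (counitA : A →ₗ[K] K)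
    (coact : A →ₗ[K] H ⊗[K] A) : Prop where
  coalgebra : IsHomCoalgebra α comulA counitA
  comodule : IsHomComodule β comul counit α coact
  coact_comul : ∀ c : A,
    TensorProduct.map (β ^ 2).toLinearMap comulA (coact c) =
      codiagonal mul coact coact (comulA c)
  coact_counit : ∀ c : A,
    TensorProduct.rid K H (counitA.lTensor H (coact c)) = counitA c • one

/-- Applies `f : N ⊗ P → P' ⊗ N'` to the two middle factors of `(M ⊗ N) ⊗ (P ⊗ Q)`. -/
noncomputable def middle (f : N ⊗[K] P →ₗ[K] P' ⊗[K] N') :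
    (M ⊗[K] N) ⊗[K] (P ⊗[K] Q) →ₗ[K] (M ⊗[K] P') ⊗[K] (N' ⊗[K] Q) :=
  (TensorProduct.assoc K M P' (N' ⊗[K] Q)).symm.toLinearMap ∘ₗ
    LinearMap.lTensor M
      ((TensorProduct.assoc K P' N' Q).toLinearMap ∘ₗ f.rTensor Q ∘ₗ
        (TensorProduct.assoc K N P Q).symm.toLinearMap) ∘ₗ
    (TensorProduct.assoc K M N (P ⊗[K] Q)).toLinearMap

/-- The map `h ⊗ a ↦ (h₁ ▷ α⁻¹(a)) ⊗ β⁻¹(h₂)`. -/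
noncomputable def smashTwist (β : H ≃ₗ[K] H) (comul : H →ₗ[K] H ⊗[K] H)
    (α : A ≃ₗ[K] A) (act : H ⊗[K] A →ₗ[K] A) : H ⊗[K] A →ₗ[K] A ⊗[K] H :=
  TensorProduct.map act β.symm.toLinearMap ∘ₗ
    (TensorProduct.rightComm K H H A).toLinearMap ∘ₗ
      TensorProduct.map comul α.symm.toLinearMap

/-- The smash product multiplication
`(a ⊗ h)(a' ⊗ h') = a(h₁ ▷ α⁻¹(a')) ⊗ β⁻¹(h₂)h'` on `A ⊗ H`. -/
noncomputable def smashMul (β : H ≃ₗ[K] H) (mul : H ⊗[K] H →ₗ[K] H)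
    (comul : H →ₗ[K] H ⊗[K] H) (α : A ≃ₗ[K] A) (mulA : A ⊗[K] A →ₗ[K] A)
    (act : H ⊗[K] A →ₗ[K] A) :
    (A ⊗[K] H) ⊗[K] (A ⊗[K] H) →ₗ[K] A ⊗[K] H :=
  TensorProduct.map mulA mul ∘ₗ middle (smashTwist β comul α act)

/-- The map `a ⊗ h ↦ a₋₁β⁻¹(h) ⊗ α⁻¹(a₀)`. -/
noncomputable def smashCotwist (β : H ≃ₗ[K] H) (mul : H ⊗[K] H →ₗ[K] H)
    (α : A ≃ₗ[K] A) (coact : A →ₗ[K] H ⊗[K] A) : A ⊗[K] H →ₗ[K] H ⊗[K] A :=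
  TensorProduct.map mul α.symm.toLinearMap ∘ₗ
    (TensorProduct.rightComm K H A H).toLinearMap ∘ₗ
      TensorProduct.map coact β.symm.toLinearMap

/-- The smash coproduct comultiplication
`Δ(a ⊗ h) = (a₁ ⊗ a₂₋₁β⁻¹(h₁)) ⊗ (α⁻¹(a₂₀) ⊗ h₂)` on `A ⊗ H`. -/
noncomputable def smashComul (β : H ≃ₗ[K] H) (mul : H ⊗[K] H →ₗ[K] H)
    (comul : H →ₗ[K] H ⊗[K] H) (α : A ≃ₗ[K] A) (comulA : A →ₗ[K] A ⊗[K] A)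
    (coact : A →ₗ[K] H ⊗[K] A) :
    A ⊗[K] H →ₗ[K] (A ⊗[K] H) ⊗[K] (A ⊗[K] H) :=
  middle (smashCotwist β mul α coact) ∘ₗ TensorProduct.map comulA comul

/-- The counit `ε_A ⊗ ε_H` on `A ⊗ H`. -/
noncomputable def tensorCounit (counitA : A →ₗ[K] K) (counit : H →ₗ[K] K) :
    A ⊗[K] H →ₗ[K] K :=
  (TensorProduct.lid K K).toLinearMap ∘ₗ TensorProduct.map counitA counit

/-- The space `A ⊗ H` with the smash product multiplication, unit `1 ⊗ 1`, the smash coproduct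
comultiplication, counit `ε_A ⊗ ε_H` and structure map `α ⊗ β` is a Hom-bialgebra, the
Radford biproduct Hom-bialgebra. -/
def IsRadfordBiproduct (β : H ≃ₗ[K] H) (mul : H ⊗[K] H →ₗ[K] H) (one : H)
    (comul : H →ₗ[K] H ⊗[K] H) (counit : H →ₗ[K] K)
    (α : A ≃ₗ[K] A) (mulA : A ⊗[K] A →ₗ[K] A) (oneA : A)
    (comulA : A →ₗ[K] A ⊗[K] A) (counitA : A →ₗ[K] K)
    (act : H ⊗[K] A →ₗ[K] A) (coact : A →ₗ[K] H ⊗[K] A) : Prop :=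
  IsHomBialgebra (TensorProduct.congr α β)
    (smashMul β mul comul α mulA act) (oneA ⊗ₜ[K] one)
    (smashComul β mul comul α comulA coact) (tensorCounit counitA counit)

/-- `(M, ▷, ρ, α)` is a (left-left) Hom-Yetter-Drinfeld module over the Hom-bialgebra
`(H, μ, 1, Δ, ε, β)`: a left Hom-module and left Hom-comodule such that
`h₁β(m₋₁) ⊗ (β³(h₂) ▷ m₀) = (β²(h₁) ▷ m)₋₁h₂ ⊗ (β²(h₁) ▷ m)₀`. -/
structure IsHomYetterDrinfeld (β : H ≃ₗ[K] H) (mul : H ⊗[K] H →ₗ[K] H) (one : H)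
    (comul : H →ₗ[K] H ⊗[K] H) (counit : H →ₗ[K] K)
    (α : M ≃ₗ[K] M) (act : H ⊗[K] M →ₗ[K] M) (coact : M →ₗ[K] H ⊗[K] M) : Prop where
  module : IsHomModule β mul one α act
  comodule : IsHomComodule β comul counit α coact
  compat : ∀ (h : H) (m : M),
    TensorProduct.map mul act
        (TensorProduct.tensorTensorTensorComm K H H H M
          ((β ^ 3).toLinearMap.lTensor H (comul h) ⊗ₜ[K]
            β.toLinearMap.rTensor M (coact m))) =
      mul.rTensor M
        (TensorProduct.rightComm K H M H
          (LinearMap.rTensor H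
            (coact ∘ₗ act ∘ₗ (TensorProduct.mk K H M).flip m ∘ₗ (β ^ 2).toLinearMap)
            (comul h)))

/-- A morphism `f : (M, ▷, ρ, α) → (N, ▷, ρ, α)` of the Hom-Yetter-Drinfeld category: a linear
map that commutes with the structure maps, the actions and the coactions. -/
structure IsHomYDMorphism
    (αM : M ≃ₗ[K] M) (actM : H ⊗[K] M →ₗ[K] M) (coactM : M →ₗ[K] H ⊗[K] M)
    (αN : N ≃ₗ[K] N) (actN : H ⊗[K] N →ₗ[K] N) (coactN : N →ₗ[K] H ⊗[K] N)
    (f : M →ₗ[K] N) : Prop where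
  map_structure : ∀ m : M, f (αM m) = αN (f m)
  map_act : ∀ (h : H) (m : M), f (actM (h ⊗ₜ m)) = actN (h ⊗ₜ f m)
  map_coact : ∀ m : M, coactN (f m) = f.lTensor H (coactM m)

/-- The action `h ⊗ k ↦ ε(h)k` on the unit object `(K, id)`. -/
noncomputable def unitAct (counit : H →ₗ[K] K) : H ⊗[K] K →ₗ[K] K :=
  (TensorProduct.lid K K).toLinearMap ∘ₗ counit.rTensor K

/-- The coaction `k ↦ 1 ⊗ k` on the unit object `(K, id)`. -/
noncomputable def unitCoact (one : H) : K →ₗ[K] H ⊗[K] K :=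
  TensorProduct.mk K H K one

/-- The braiding `c_{M,N}(m ⊗ n) = (β²(m₋₁) ▷ α_N⁻¹(n)) ⊗ α_M⁻¹(m₀)`. -/
noncomputable def braiding (β : H ≃ₗ[K] H) (αM : M ≃ₗ[K] M) (coactM : M →ₗ[K] H ⊗[K] M)
    (αN : N ≃ₗ[K] N) (actN : H ⊗[K] N →ₗ[K] N) : M ⊗[K] N →ₗ[K] N ⊗[K] M :=
  TensorProduct.map (actN ∘ₗ TensorProduct.map (β ^ 2).toLinearMap αN.symm.toLinearMap)
      αM.symm.toLinearMap ∘ₗ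
    (TensorProduct.rightComm K H M N).toLinearMap ∘ₗ
      coactM.rTensor N

/-- The braided multiplication `(μ ⊗ μ) ∘ (id ⊗ c_{A,A} ⊗ id)` on `A ⊗ A`. -/
noncomputable def braidedMul (β : H ≃ₗ[K] H) (α : A ≃ₗ[K] A) (mulA : A ⊗[K] A →ₗ[K] A)
    (act : H ⊗[K] A →ₗ[K] A) (coact : A →ₗ[K] H ⊗[K] A) :
    (A ⊗[K] A) ⊗[K] (A ⊗[K] A) →ₗ[K] A ⊗[K] A :=
  TensorProduct.map mulA mulA ∘ₗ middle (braiding β α coact α act)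

/-- `(A, α)` is a (Hom-)bialgebra in the Hom-Yetter-Drinfeld category over the Hom-bialgebra
`(H, μ, 1, Δ, ε, β)`: it is an object of the category, a Hom-algebra and a Hom-coalgebra whose
multiplication, unit, comultiplication and counit are morphisms of the category, and the
comultiplication and the counit are multiplicative and unital, where `A ⊗ A` carries the
braided multiplication. -/
structure IsBialgebraInHomYD (β : H ≃ₗ[K] H) (mul : H ⊗[K] H →ₗ[K] H) (one : H)
    (comul : H →ₗ[K] H ⊗[K] H) (counit : H →ₗ[K] K)
    (α : A ≃ₗ[K] A) (mulA : A ⊗[K] A →ₗ[K] A) (oneA : A)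
    (comulA : A →ₗ[K] A ⊗[K] A) (counitA : A →ₗ[K] K)
    (act : H ⊗[K] A →ₗ[K] A) (coact : A →ₗ[K] H ⊗[K] A) : Prop where
  object : IsHomYetterDrinfeld β mul one comul counit α act coact
  algebra : IsHomAlgebra α mulA oneA
  coalgebra : IsHomCoalgebra α comulA counitA
  mul_morphism : IsHomYDMorphism
    (TensorProduct.congr α α) (tensorAct comul act act) (tensorCoact β mul coact coact)
    α act coact mulA
  unit_morphism : IsHomYDMorphism
    (LinearEquiv.refl K K) (unitAct counit) (unitCoact one)
    α act coact (LinearMap.toSpanSingleton K A oneA)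
  comul_morphism : IsHomYDMorphism
    α act coact
    (TensorProduct.congr α α) (tensorAct comul act act) (tensorCoact β mul coact coact) comulA
  counit_morphism : IsHomYDMorphism
    α act coact
    (LinearEquiv.refl K K) (unitAct counit) (unitCoact one) counitA
  comul_mul : ∀ a b : A,
    comulA (mulA (a ⊗ₜ b)) = braidedMul β α mulA act coact (comulA a ⊗ₜ comulA b)
  comul_one : comulA oneA = oneA ⊗ₜ oneA
  counit_mul : ∀ a b : A, counitA (mulA (a ⊗ₜ b)) = counitA a * counitA b
  counit_one : counitA oneA = 1

end

end HomBiproduct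

/-!
The theorem is Radford's biproduct theorem up to twisting. Since the structure maps `α` and `β` are
bijective, every Hom-structure is the twist of an ordinary one: a Hom-algebra is `α ∘ m` for an
ordinary algebra `m` with automorphism `α`, a Hom-coalgebra is `d ∘ α` for an ordinary coalgebra
`d`, and likewise for actions and coactions (`isHomBialgebra_twist_iff`,
`isBiproductDatum_of_twist`). As `β² = id`, the powers of `β` in the smash product, the smash
coproduct, the braiding and the Yetter-Drinfeld condition cancel, so both sides of the equivalence
become the ordinary ones for the untwisted maps (`isRadfordBiproduct_twist_iff`,
`isBialgebraInHomYD_twist_iff`).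

In the ordinary case, `A ⊗ H` is always an algebra and a coalgebra. If `A` is a bialgebra in
Yetter-Drinfeld modules, multiplicativity of the smash coproduct is a computation whose essential
step is the Yetter-Drinfeld condition inside `h₁ ⊗ h₂ ⊗ h₃ ⊗ h₄`
(`IsBiproductDatum.smashComul_smashMul`). Conversely, the conditions on `A` are recovered from
multiplicativity on products `(a ⊗ 1)(b ⊗ 1)` and `(1 ⊗ h)(a ⊗ 1)` by applying the counits to
suitable tensor factors (`IsBiproductDatum.isBraidedBialgebra_of_smash`).

Sweedler notation is rendered by `sweedler t f`, a sum over a chosen decomposition of the tensor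
`t`; sums may be nested and interchanged freely, and coassociativity and the like are rewriting
rules whose multilinearity hypotheses are left to `fun_prop`.
-/

namespace HomBiproduct
/-! ### Sweedler sums -/

section Sweedler

variable {K : Type*} [Field K]
variable {X : Type*} [AddCommMonoid X] [Module K X]
variable {Y : Type*} [AddCommMonoid Y] [Module K Y]
variable {Z : Type*} [AddCommMonoid Z] [Module K Z]
variable {V : Type*} [AddCommMonoid V] [Module K V]
variable {W : Type*} [AddCommMonoid W] [Module K W]

-- Multilinearity of a summand is the side condition of every Sweedler rule below; with
-- `IsLinearMap` known to `fun_prop` it can be discharged inside `simp`.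
attribute [fun_prop] IsLinearMap

@[fun_prop]
theorem isLinearMap_id : IsLinearMap K (fun x : X => x) := ⟨fun _ _ => rfl, fun _ _ => rfl⟩

@[fun_prop]
theorem isLinearMap_comp {f : Y → Z} {g : X → Y} (hf : IsLinearMap K f) (hg : IsLinearMap K g) :
    IsLinearMap K (fun x => f (g x)) :=
  ⟨fun x y => by rw [hg.map_add, hf.map_add], fun c x => by rw [hg.map_smul, hf.map_smul]⟩

@[fun_prop]
theorem isLinearMap_tmul_left (y : Y) : IsLinearMap K (fun x : X => x ⊗ₜ[K] y) :=
  ⟨fun a b => TensorProduct.add_tmul a b y, fun c a => TensorProduct.smul_tmul' c a y⟩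

@[fun_prop]
theorem isLinearMap_tmul_right (x : X) : IsLinearMap K (fun y : Y => x ⊗ₜ[K] y) :=
  ⟨fun a b => TensorProduct.tmul_add x a b, fun c a => TensorProduct.tmul_smul c x a⟩

@[fun_prop]
theorem isLinearMap_linearMap (f : X →ₗ[K] Y) : IsLinearMap K (fun x => f x) := f.isLinear

@[fun_prop]
theorem isLinearMap_linearEquiv (f : X ≃ₗ[K] Y) : IsLinearMap K (fun x => f x) :=
  f.toLinearMap.isLinear

@[fun_prop]
theorem isLinearMap_smul_left (v : V) : IsLinearMap K (fun c : K => c • v) :=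
  IsLinearMap.isLinearMap_smul' v

@[fun_prop]
theorem isLinearMap_smul_right (c : K) : IsLinearMap K (fun v : V => c • v) :=
  IsLinearMap.isLinearMap_smul c

@[fun_prop]
theorem isLinearMap_mul_left (d : K) : IsLinearMap K (fun c : K => c * d) :=
  (LinearMap.mulRight K d).isLinear

@[fun_prop]
theorem isLinearMap_mul_right (d : K) : IsLinearMap K (fun c : K => d * c) :=
  (LinearMap.mulLeft K d).isLinear

/-- The Sweedler sum `∑ f t₁ t₂` over a decomposition `t = ∑ t₁ ⊗ t₂`. The decomposition is an
arbitrary fixed one and `f` an arbitrary function, so that no linearity has to be bundled into the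
summand; the value is independent of the decomposition when `f` is bilinear (`exists_lift`,
`sweedler_eq_of_lift`), and only such `f` are meaningful. -/
noncomputable def sweedler (t : X ⊗[K] Y) (f : X → Y → V) : V :=
  ∑ p ∈ (TensorProduct.exists_finset t).choose, f p.1 p.2

theorem eq_sweedler (t : X ⊗[K] Y) : t = sweedler t fun x y => x ⊗ₜ[K] y :=
  (TensorProduct.exists_finset t).choose_spec

omit [Module K V] in
/-- Interchange of two independent Sweedler sums. -/
theorem sweedler_comm (t : X ⊗[K] Y) {X' Y' : Type*} [AddCommMonoid X'] [Module K X']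
    [AddCommMonoid Y'] [Module K Y'] (u : X' ⊗[K] Y') (f : X → Y → X' → Y' → V) :
    sweedler t (fun x y => sweedler u fun x' y' => f x y x' y') =
      sweedler u fun x' y' => sweedler t fun x y => f x y x' y' :=
  Finset.sum_comm

theorem _root_.IsLinearMap.map_sweedler {g : V → W} (hg : IsLinearMap K g) (t : X ⊗[K] Y)
    (f : X → Y → V) : g (sweedler t f) = sweedler t fun x y => g (f x y) :=
  map_sum (hg.mk' g) _ _

theorem map_sweedler (g : V →ₗ[K] W) (t : X ⊗[K] Y)
    (f : X → Y → V) : g (sweedler t f) = sweedler t fun x y => g (f x y) :=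
  map_sum g _ _

/-- A Sweedler sum with bilinear summand is the value of the induced linear map. -/
theorem sweedler_eq_of_lift (t : X ⊗[K] Y) {f : X → Y → V} (g : X ⊗[K] Y →ₗ[K] V)
    (h : ∀ x y, f x y = g (x ⊗ₜ y)) : sweedler t f = g t := by
  conv_rhs => rw [eq_sweedler t, map_sweedler]
  simp only [← h]

theorem exists_lift {f : X → Y → V} (h₁ : ∀ y, IsLinearMap K fun x => f x y)
    (h₂ : ∀ x, IsLinearMap K fun y => f x y) :
    ∃ g : X ⊗[K] Y →ₗ[K] V, ∀ x y, f x y = g (x ⊗ₜ y) :=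
  ⟨TensorProduct.lift (LinearMap.mk₂ K f (fun a b y => (h₁ y).map_add a b)
    (fun c a y => (h₁ y).map_smul c a) (fun x a b => (h₂ x).map_add a b)
    (fun c x a => (h₂ x).map_smul c a)), fun x y => by simp⟩

@[fun_prop]
theorem isLinearMap_sweedler_tensor {f : X → Y → V} (h₁ : ∀ y, IsLinearMap K fun x => f x y)
    (h₂ : ∀ x, IsLinearMap K fun y => f x y) :
    IsLinearMap K fun t : X ⊗[K] Y => sweedler t f := by
  obtain ⟨g, hg⟩ := exists_lift h₁ h₂
  simp only [sweedler_eq_of_lift _ g hg]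
  exact g.isLinear

@[fun_prop]
theorem isLinearMap_sweedler (t : X ⊗[K] Y) {f : W → X → Y → V}
    (h : ∀ x y, IsLinearMap K fun w => f w x y) :
    IsLinearMap K fun w => sweedler t (f w) := by
  constructor
  · intro a b
    simp only [sweedler, (h _ _).map_add, Finset.sum_add_distrib]
  · intro c a
    simp only [sweedler, (h _ _).map_smul, Finset.smul_sum]

theorem sweedler_tmul (x : X) (y : Y) {f : X → Y → V} (h₁ : ∀ y, IsLinearMap K fun x => f x y)
    (h₂ : ∀ x, IsLinearMap K fun y => f x y) : sweedler (x ⊗ₜ[K] y) f = f x y := by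
  obtain ⟨g, hg⟩ := exists_lift h₁ h₂
  rw [sweedler_eq_of_lift _ g hg, hg]

/-- A Sweedler sum over a tensor that is itself given as a Sweedler sum. -/
theorem sweedler_sweedler {P Q : Type*} [AddCommMonoid P] [Module K P] [AddCommMonoid Q]
    [Module K Q] (t : P ⊗[K] Q) (u : P → Q → X ⊗[K] Y) {f : X → Y → V}
    (h₁ : ∀ y, IsLinearMap K fun x => f x y) (h₂ : ∀ x, IsLinearMap K fun y => f x y) :
    sweedler (sweedler t u) f = sweedler t fun p q => sweedler (u p q) f :=
  (isLinearMap_sweedler_tensor h₁ h₂).map_sweedler t u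


theorem sweedler_map {X' Y' : Type*} [AddCommMonoid X'] [Module K X'] [AddCommMonoid Y']
    [Module K Y'] (g : X →ₗ[K] X') (h : Y →ₗ[K] Y') (t : X ⊗[K] Y) {f : X' → Y' → V}
    (h₁ : ∀ y, IsLinearMap K fun x => f x y) (h₂ : ∀ x, IsLinearMap K fun y => f x y) :
    sweedler (TensorProduct.map g h t) f = sweedler t fun x y => f (g x) (h y) := by
  conv_lhs => rw [eq_sweedler t, map_sweedler]
  simp (disch := fun_prop) only [TensorProduct.map_tmul, sweedler_sweedler, sweedler_tmul]

theorem eq_of_tmul {f g : X ⊗[K] Y → V} (hf : IsLinearMap K f) (hg : IsLinearMap K g)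
    (h : ∀ x y, f (x ⊗ₜ y) = g (x ⊗ₜ y)) (t : X ⊗[K] Y) : f t = g t := by
  rw [eq_sweedler t, hf.map_sweedler, hg.map_sweedler]
  simp only [h]

variable {M : Type*} [AddCommMonoid M] [Module K M]
variable {N : Type*} [AddCommMonoid N] [Module K N]
variable {P : Type*} [AddCommMonoid P] [Module K P]
variable {Q : Type*} [AddCommMonoid Q] [Module K Q]

theorem map_eq_sweedler (f : M →ₗ[K] P) (g : N →ₗ[K] Q) (t : M ⊗[K] N) :
    TensorProduct.map f g t = sweedler t fun x y => f x ⊗ₜ[K] g y := by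
  conv_lhs => rw [eq_sweedler t, map_sweedler]
  simp only [TensorProduct.map_tmul]

theorem rTensor_eq_sweedler (f : M →ₗ[K] P) (t : M ⊗[K] N) :
    f.rTensor N t = sweedler t fun x y => f x ⊗ₜ[K] y :=
  map_eq_sweedler f LinearMap.id t

theorem lTensor_eq_sweedler (f : N →ₗ[K] P) (t : M ⊗[K] N) :
    f.lTensor M t = sweedler t fun x y => x ⊗ₜ[K] f y :=
  map_eq_sweedler LinearMap.id f t

theorem sweedler_tmul_left (t : M ⊗[K] N) (f : M → N → P) (q : Q) :
    sweedler t f ⊗ₜ[K] q = sweedler t fun x y => f x y ⊗ₜ[K] q :=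
  (isLinearMap_tmul_left q).map_sweedler t f

theorem tmul_sweedler_right (t : M ⊗[K] N) (f : M → N → P) (q : Q) :
    q ⊗ₜ[K] sweedler t f = sweedler t fun x y => q ⊗ₜ[K] f x y :=
  (isLinearMap_tmul_right q).map_sweedler t f

theorem map_sweedler_equiv (g : P ≃ₗ[K] Q) (t : M ⊗[K] N) (f : M → N → P) :
    g (sweedler t f) = sweedler t fun x y => g (f x y) :=
  map_sweedler g.toLinearMap t f

theorem smul_sweedler (c : K) (t : M ⊗[K] N) (f : M → N → P) :
    c • sweedler t f = sweedler t fun x y => c • f x y :=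
  (isLinearMap_smul_right c).map_sweedler t f

theorem sweedler_assoc_tmul (t : M ⊗[K] N) (p : P) {f : M → N ⊗[K] P → V}
    (h₁ : ∀ y, IsLinearMap K fun x => f x y) (h₂ : ∀ x, IsLinearMap K fun y => f x y) :
    sweedler (TensorProduct.assoc K M N P (t ⊗ₜ[K] p)) f =
      sweedler t fun x y => f x (y ⊗ₜ[K] p) := by
  conv_lhs => rw [eq_sweedler t]
  simp (disch := fun_prop) only [sweedler_tmul_left, map_sweedler_equiv, TensorProduct.assoc_tmul,
    sweedler_sweedler, sweedler_tmul]

end Sweedler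

/-! ### The structures without twists -/

section Classical

variable {K : Type*} [Field K]
variable {H : Type*} [AddCommGroup H] [Module K H]
variable {A : Type*} [AddCommGroup A] [Module K A]
variable (mul : H ⊗[K] H →ₗ[K] H) (one : H) (comul : H →ₗ[K] H ⊗[K] H) (counit : H →ₗ[K] K)
variable (mulA : A ⊗[K] A →ₗ[K] A) (oneA : A) (comulA : A →ₗ[K] A ⊗[K] A) (counitA : A →ₗ[K] K)
variable (act : H ⊗[K] A →ₗ[K] A) (coact : A →ₗ[K] H ⊗[K] A)

local notation:70 x:70 " ⋆ " y:71 => mul (x ⊗ₜ[K] y)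
local notation:70 x:70 " ⋄ " y:71 => mulA (x ⊗ₜ[K] y)
local notation:72 x:73 " ▷ " y:72 => act (x ⊗ₜ[K] y)

/-- The data of Radford's biproduct in the ordinary (untwisted) sense: `H` is a bialgebra and `A` is
a left `H`-module algebra and a left `H`-comodule coalgebra. The subscript `A` marks the laws of the
multiplication and comultiplication of `A`, and all laws are written with Sweedler sums. -/
structure IsBiproductDatum : Prop where
  mul_assoc : ∀ x y z, x ⋆ (y ⋆ z) = x ⋆ y ⋆ z
  one_mul : ∀ x, one ⋆ x = x
  mul_one : ∀ x, x ⋆ one = x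
  coassoc : ∀ h, (sweedler (comul h) fun x y => sweedler (comul y) fun y₁ y₂ =>
      x ⊗ₜ[K] (y₁ ⊗ₜ[K] y₂)) =
    sweedler (comul h) fun x y => sweedler (comul x) fun x₁ x₂ => x₁ ⊗ₜ[K] (x₂ ⊗ₜ[K] y)
  counit_left : ∀ h, (sweedler (comul h) fun x y => counit x • y) = h
  counit_right : ∀ h, (sweedler (comul h) fun x y => counit y • x) = h
  comul_mul : ∀ x y, comul (x ⋆ y) = sweedler (comul x) fun x₁ x₂ => sweedler (comul y)
    fun y₁ y₂ => (x₁ ⋆ y₁) ⊗ₜ[K] (x₂ ⋆ y₂)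
  comul_one : comul one = one ⊗ₜ[K] one
  counit_mul : ∀ x y, counit (x ⋆ y) = counit x * counit y
  counit_one : counit one = 1
  mulA_assoc : ∀ a b c, a ⋄ (b ⋄ c) = a ⋄ b ⋄ c
  oneA_mul : ∀ a, oneA ⋄ a = a
  mul_oneA : ∀ a, a ⋄ oneA = a
  act_act : ∀ x y a, x ▷ y ▷ a = (x ⋆ y) ▷ a
  one_act : ∀ a, one ▷ a = a
  act_mul : ∀ h a b, h ▷ (a ⋄ b) = sweedler (comul h) fun x y => (x ▷ a) ⋄ (y ▷ b)
  act_one : ∀ h, h ▷ oneA = counit h • oneA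
  coassocA : ∀ a, (sweedler (comulA a) fun x y => sweedler (comulA y) fun y₁ y₂ =>
      x ⊗ₜ[K] (y₁ ⊗ₜ[K] y₂)) =
    sweedler (comulA a) fun x y => sweedler (comulA x) fun x₁ x₂ => x₁ ⊗ₜ[K] (x₂ ⊗ₜ[K] y)
  counitA_left : ∀ a, (sweedler (comulA a) fun x y => counitA x • y) = a
  counitA_right : ∀ a, (sweedler (comulA a) fun x y => counitA y • x) = a
  coact_coact : ∀ a, (sweedler (coact a) fun x y => sweedler (coact y) fun y₁ y₂ =>
      x ⊗ₜ[K] (y₁ ⊗ₜ[K] y₂)) =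
    sweedler (coact a) fun x y => sweedler (comul x) fun x₁ x₂ => x₁ ⊗ₜ[K] (x₂ ⊗ₜ[K] y)
  counit_coact : ∀ a, (sweedler (coact a) fun x y => counit x • y) = a
  coact_comul : ∀ a, (sweedler (coact a) fun x y => sweedler (comulA y) fun y₁ y₂ =>
      x ⊗ₜ[K] (y₁ ⊗ₜ[K] y₂)) =
    sweedler (comulA a) fun b c => sweedler (coact b) fun x₁ y₁ => sweedler (coact c)
      fun x₂ y₂ => (x₁ ⋆ x₂) ⊗ₜ[K] (y₁ ⊗ₜ[K] y₂)
  coact_counit : ∀ a, (sweedler (coact a) fun x y => counitA y • x) = counitA a • one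

/-- What is needed of an `IsBiproductDatum` in order that `A` be a bialgebra in the ordinary
category of left-left Yetter-Drinfeld modules over `H`: the comultiplication of `A` is multiplicative for the
braided product on `A ⊗ A`, the counit is an algebra map, `A` is a comodule algebra and a module
coalgebra, and action and coaction satisfy the Yetter-Drinfeld condition `compat`. -/
structure IsBraidedBialgebra : Prop where
  comul_mul : ∀ a b, comulA (a ⋄ b) = sweedler (comulA a) fun a₁ a₂ => sweedler (coact a₂)
    fun x y => sweedler (comulA b) fun b₁ b₂ => (a₁ ⋄ (x ▷ b₁)) ⊗ₜ[K] (y ⋄ b₂)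
  comul_one : comulA oneA = oneA ⊗ₜ[K] oneA
  counit_mul : ∀ a b, counitA (a ⋄ b) = counitA a * counitA b
  counit_one : counitA oneA = 1
  coact_mul : ∀ a b, coact (a ⋄ b) = sweedler (coact a) fun x₁ y₁ => sweedler (coact b)
    fun x₂ y₂ => (x₁ ⋆ x₂) ⊗ₜ[K] (y₁ ⋄ y₂)
  coact_one : coact oneA = one ⊗ₜ[K] oneA
  comul_act : ∀ h a, comulA (h ▷ a) = sweedler (comul h) fun x y => sweedler (comulA a)
    fun a₁ a₂ => (x ▷ a₁) ⊗ₜ[K] (y ▷ a₂)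
  counit_act : ∀ h a, counitA (h ▷ a) = counit h * counitA a
  compat : ∀ h a, (sweedler (comul h) fun h₁ h₂ => sweedler (coact a) fun x y =>
      (h₁ ⋆ x) ⊗ₜ[K] (h₂ ▷ y)) =
    sweedler (comul h) fun h₁ h₂ => sweedler (coact (h₁ ▷ a)) fun x y => (x ⋆ h₂) ⊗ₜ[K] y

variable {mul one comul counit mulA oneA comulA counitA act coact}

/-! ### Rewriting rules for Sweedler sums -/

section Rules
variable {V : Type*} [AddCommGroup V] [Module K V]
namespace IsBiproductDatum
variable (D : IsBiproductDatum mul one comul counit mulA oneA comulA counitA act coact)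
include D

theorem sweedler_coassoc (h : H) {f : H → H → H → V}
    (h₁ : ∀ y z, IsLinearMap K fun x => f x y z) (h₂ : ∀ x z, IsLinearMap K fun y => f x y z)
    (h₃ : ∀ x y, IsLinearMap K fun z => f x y z) :
    (sweedler (comul h) fun x y => sweedler (comul y) fun y₁ y₂ => f x y₁ y₂) =
    sweedler (comul h) fun x y => sweedler (comul x) fun x₁ x₂ => f x₁ x₂ y := by
  have := congrArg (fun t => sweedler t fun x r => sweedler r fun y z => f x y z) (D.coassoc h)
  simpa (disch := fun_prop) only [sweedler_sweedler, sweedler_tmul] using this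

theorem sweedler_coassocA (a : A) {f : A → A → A → V}
    (h₁ : ∀ y z, IsLinearMap K fun x => f x y z) (h₂ : ∀ x z, IsLinearMap K fun y => f x y z)
    (h₃ : ∀ x y, IsLinearMap K fun z => f x y z) :
    (sweedler (comulA a) fun x y => sweedler (comulA y) fun y₁ y₂ => f x y₁ y₂) =
    sweedler (comulA a) fun x y => sweedler (comulA x) fun x₁ x₂ => f x₁ x₂ y := by
  have := congrArg (fun t => sweedler t fun x r => sweedler r fun y z => f x y z) (D.coassocA a)
  simpa (disch := fun_prop) only [sweedler_sweedler, sweedler_tmul] using this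

theorem sweedler_coact_coact (a : A) {f : H → H → A → V}
    (h₁ : ∀ y z, IsLinearMap K fun x => f x y z) (h₂ : ∀ x z, IsLinearMap K fun y => f x y z)
    (h₃ : ∀ x y, IsLinearMap K fun z => f x y z) :
    (sweedler (coact a) fun x y => sweedler (coact y) fun y₁ y₂ => f x y₁ y₂) =
    sweedler (coact a) fun x y => sweedler (comul x) fun x₁ x₂ => f x₁ x₂ y := by
  have := congrArg (fun t => sweedler t fun x r => sweedler r fun y z => f x y z)
    (D.coact_coact a)
  simpa (disch := fun_prop) only [sweedler_sweedler, sweedler_tmul] using this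

theorem sweedler_coact_comul (a : A) {f : H → A → A → V}
    (h₁ : ∀ y z, IsLinearMap K fun x => f x y z) (h₂ : ∀ x z, IsLinearMap K fun y => f x y z)
    (h₃ : ∀ x y, IsLinearMap K fun z => f x y z) :
    (sweedler (coact a) fun x y => sweedler (comulA y) fun y₁ y₂ => f x y₁ y₂) =
    sweedler (comulA a) fun b c => sweedler (coact b) fun x₁ y₁ => sweedler (coact c)
      fun x₂ y₂ => f (x₁ ⋆ x₂) y₁ y₂ := by
  have := congrArg (fun t => sweedler t fun x r => sweedler r fun y z => f x y z)
    (D.coact_comul a)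
  simpa (disch := fun_prop) only [sweedler_sweedler, sweedler_tmul] using this

theorem sweedler_counit_left (h : H) {f : H → V} (hf : IsLinearMap K f) :
    (sweedler (comul h) fun x y => counit x • f y) = f h := by
  conv_rhs => rw [← D.counit_left h, hf.map_sweedler]
  simp only [hf.map_smul]

theorem sweedler_counit_right (h : H) {f : H → V} (hf : IsLinearMap K f) :
    (sweedler (comul h) fun x y => counit y • f x) = f h := by
  conv_rhs => rw [← D.counit_right h, hf.map_sweedler]
  simp only [hf.map_smul]

theorem sweedler_counitA_left (a : A) {f : A → V} (hf : IsLinearMap K f) :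
    (sweedler (comulA a) fun x y => counitA x • f y) = f a := by
  conv_rhs => rw [← D.counitA_left a, hf.map_sweedler]
  simp only [hf.map_smul]

theorem sweedler_counitA_right (a : A) {f : A → V} (hf : IsLinearMap K f) :
    (sweedler (comulA a) fun x y => counitA y • f x) = f a := by
  conv_rhs => rw [← D.counitA_right a, hf.map_sweedler]
  simp only [hf.map_smul]

theorem sweedler_counit_coact (a : A) {f : A → V} (hf : IsLinearMap K f) :
    (sweedler (coact a) fun x y => counit x • f y) = f a := by
  conv_rhs => rw [← D.counit_coact a, hf.map_sweedler]
  simp only [hf.map_smul]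

theorem sweedler_coact_counit (a : A) {f : H → V} (hf : IsLinearMap K f) :
    (sweedler (coact a) fun x y => counitA y • f x) = counitA a • f one := by
  rw [← hf.map_smul, ← D.coact_counit a, hf.map_sweedler]
  simp only [hf.map_smul]

/-- The fourfold comultiplication `h₁ ⊗ h₂ ⊗ h₃ ⊗ h₄`, bracketed so that the two middle factors
come from a single comultiplication. -/
theorem sweedler_comul₄ (h : H) {f : H → H → H → H → V}
    (h₁ : ∀ y z w, IsLinearMap K fun x => f x y z w)
    (h₂ : ∀ x z w, IsLinearMap K fun y => f x y z w)
    (h₃ : ∀ x y w, IsLinearMap K fun z => f x y z w)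
    (h₄ : ∀ x y z, IsLinearMap K fun w => f x y z w) :
    (sweedler (comul h) fun x y => sweedler (comul x) fun x₁ x₂ => sweedler (comul y)
      fun y₁ y₂ => f x₁ x₂ y₁ y₂) =
    sweedler (comul h) fun x y => sweedler (comul x) fun x₁ x₂ => sweedler (comul x₂)
      fun z w => f x₁ z w y := by
  calc _ = sweedler (comul h) fun x y => sweedler (comul y) fun y₁ y₂ => sweedler (comul x)
            fun x₁ x₂ => f x₁ x₂ y₁ y₂ := by
          refine congrArg _ (funext₂ fun x y => ?_)
          rw [sweedler_comm]
    _ = _ := by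
          simp (disch := fun_prop) only [D.sweedler_coassoc]

/-- The Yetter-Drinfeld condition applied to the two middle factors of `h₁ ⊗ h₂ ⊗ h₃ ⊗ h₄`, the
form in which it enters the multiplicativity of the smash coproduct. -/
theorem sweedler_compat
    (P : IsBraidedBialgebra mul one comul counit mulA oneA comulA counitA act coact)
    (h : H) (a : A) {f : H → H → A → H → V}
    (h₁ : ∀ y z w, IsLinearMap K fun x => f x y z w)
    (h₂ : ∀ x z w, IsLinearMap K fun y => f x y z w)
    (h₃ : ∀ x y w, IsLinearMap K fun z => f x y z w)
    (h₄ : ∀ x y z, IsLinearMap K fun w => f x y z w) :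
    (sweedler (comul h) fun x y => sweedler (comul x) fun x₁ x₂ =>
      sweedler (coact (x₂ ▷ a)) fun u v => sweedler (comul y) fun y₁ y₂ =>
        f x₁ (u ⋆ y₁) v y₂) =
    sweedler (comul h) fun x y => sweedler (comul x) fun x₁ x₂ =>
      sweedler (coact a) fun u v => sweedler (comul y) fun y₁ y₂ =>
        f x₁ (x₂ ⋆ u) (y₁ ▷ v) y₂ := by
  calc _ = sweedler (comul h) fun x y => sweedler (comul x) fun x₁ x₂ => sweedler (comul y)
            fun y₁ y₂ => sweedler (coact (x₂ ▷ a)) fun u v => f x₁ (u ⋆ y₁) v y₂ := by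
          simp only [sweedler_comm (coact _) (comul _)]
    _ = sweedler (comul h) fun x y => sweedler (comul x) fun x₁ x₂ => sweedler (comul y)
            fun y₁ y₂ => sweedler (coact a) fun u v => f x₁ (x₂ ⋆ u) (y₁ ▷ v) y₂ := by
          rw [D.sweedler_comul₄ h (by fun_prop) (by fun_prop) (by fun_prop) (by fun_prop),
            D.sweedler_comul₄ h (by fun_prop) (by fun_prop) (by fun_prop) (by fun_prop)]
          refine congrArg _ (funext₂ fun x y => congrArg _ (funext₂ fun x₁ x₂ => ?_))
          have := congrArg (fun t => sweedler t fun u v => f x₁ u v y) (P.compat x₂ a)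
          simpa (disch := fun_prop) only [sweedler_sweedler, sweedler_tmul] using this.symm
    _ = _ := by
          simp only [sweedler_comm (coact _) (comul _)]

end IsBiproductDatum
end Rules
end Classical

/-! ### The maps of the theorem as Sweedler sums -/

section Formulas

variable {K : Type*} [Field K]
variable {H : Type*} [AddCommGroup H] [Module K H]
variable {A : Type*} [AddCommGroup A] [Module K A]
variable {M : Type*} [AddCommGroup M] [Module K M]
variable {N : Type*} [AddCommGroup N] [Module K N]
variable {P : Type*} [AddCommGroup P] [Module K P]
variable {Q : Type*} [AddCommGroup Q] [Module K Q]
variable {P' : Type*} [AddCommGroup P'] [Module K P']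
variable {N' : Type*} [AddCommGroup N'] [Module K N']

theorem middle_tmul (f : N ⊗[K] P →ₗ[K] P' ⊗[K] N') (m : M) (n : N) (p : P) (q : Q) :
    middle f ((m ⊗ₜ[K] n) ⊗ₜ[K] (p ⊗ₜ[K] q)) =
      sweedler (f (n ⊗ₜ[K] p)) fun p' n' => (m ⊗ₜ[K] p') ⊗ₜ[K] (n' ⊗ₜ[K] q) := by
  simp only [middle, LinearMap.comp_apply, LinearEquiv.coe_coe, TensorProduct.assoc_tmul,
    LinearMap.lTensor_tmul, TensorProduct.assoc_symm_tmul, LinearMap.rTensor_tmul]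
  conv_lhs => rw [eq_sweedler (f (n ⊗ₜ[K] p))]
  simp only [sweedler_tmul_left, tmul_sweedler_right, map_sweedler_equiv,
    TensorProduct.assoc_tmul, TensorProduct.assoc_symm_tmul]

theorem tensorMul_tmul (mulM : M ⊗[K] M →ₗ[K] M) (mulN : N ⊗[K] N →ₗ[K] N) (m m' : M) (n n' : N) :
    tensorMul mulM mulN ((m ⊗ₜ[K] n) ⊗ₜ[K] (m' ⊗ₜ[K] n')) =
      mulM (m ⊗ₜ m') ⊗ₜ[K] mulN (n ⊗ₜ n') := by
  simp [tensorMul]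

theorem tensorMul_eq_sweedler (mulM : M ⊗[K] M →ₗ[K] M) (mulN : N ⊗[K] N →ₗ[K] N)
    (s t : M ⊗[K] N) :
    tensorMul mulM mulN (s ⊗ₜ[K] t) = sweedler s fun m n => sweedler t fun m' n' =>
      mulM (m ⊗ₜ m') ⊗ₜ[K] mulN (n ⊗ₜ n') := by
  conv_lhs => rw [eq_sweedler s, eq_sweedler t]
  simp only [sweedler_tmul_left, tmul_sweedler_right, map_sweedler, tensorMul_tmul]
  exact sweedler_comm t s _

variable (β : H ≃ₗ[K] H) (mul : H ⊗[K] H →ₗ[K] H) (comul : H →ₗ[K] H ⊗[K] H)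
  (α : A ≃ₗ[K] A) (mulA : A ⊗[K] A →ₗ[K] A) (comulA : A →ₗ[K] A ⊗[K] A)
  (act : H ⊗[K] A →ₗ[K] A) (coact : A →ₗ[K] H ⊗[K] A)

theorem smashTwist_tmul (h : H) (a : A) :
    smashTwist β comul α act (h ⊗ₜ a) =
      sweedler (comul h) fun x y => act (x ⊗ₜ α.symm a) ⊗ₜ[K] β.symm y := by
  simp only [smashTwist, LinearMap.comp_apply, LinearEquiv.coe_coe, TensorProduct.map_tmul]
  conv_lhs => rw [eq_sweedler (comul h)]
  simp only [sweedler_tmul_left, map_sweedler_equiv, map_sweedler, TensorProduct.rightComm_tmul,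
    TensorProduct.map_tmul, LinearEquiv.coe_coe]

theorem smashCotwist_tmul (a : A) (h : H) :
    smashCotwist β mul α coact (a ⊗ₜ h) =
      sweedler (coact a) fun x y => mul (x ⊗ₜ β.symm h) ⊗ₜ[K] α.symm y := by
  simp only [smashCotwist, LinearMap.comp_apply, LinearEquiv.coe_coe, TensorProduct.map_tmul]
  conv_lhs => rw [eq_sweedler (coact a)]
  simp only [sweedler_tmul_left, map_sweedler_equiv, map_sweedler, TensorProduct.rightComm_tmul,
    TensorProduct.map_tmul, LinearEquiv.coe_coe]

theorem smashMul_tmul (a b : A) (h g : H) :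
    smashMul β mul comul α mulA act ((a ⊗ₜ h) ⊗ₜ (b ⊗ₜ g)) =
      sweedler (comul h) fun x y =>
        mulA (a ⊗ₜ act (x ⊗ₜ α.symm b)) ⊗ₜ[K] mul (β.symm y ⊗ₜ g) := by
  simp (disch := fun_prop) only [smashMul, LinearMap.comp_apply, middle_tmul, smashTwist_tmul,
    map_sweedler, sweedler_sweedler, sweedler_tmul, TensorProduct.map_tmul]

theorem smashComul_tmul (a : A) (h : H) :
    smashComul β mul comul α comulA coact (a ⊗ₜ h) =
      sweedler (comulA a) fun a₁ a₂ => sweedler (coact a₂) fun x y => sweedler (comul h)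
        fun h₁ h₂ => (a₁ ⊗ₜ[K] mul (x ⊗ₜ β.symm h₁)) ⊗ₜ[K] (α.symm y ⊗ₜ[K] h₂) := by
  simp only [smashComul, LinearMap.comp_apply, TensorProduct.map_tmul]
  conv_lhs => rw [eq_sweedler (comulA a), eq_sweedler (comul h)]
  simp (disch := fun_prop) only [sweedler_tmul_left, tmul_sweedler_right, map_sweedler,
    middle_tmul, smashCotwist_tmul, sweedler_sweedler, sweedler_tmul]
  simp only [sweedler_comm (comul h)]

theorem tensorCounit_tmul (counitA : A →ₗ[K] K) (counit : H →ₗ[K] K) (a : A) (h : H) :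
    tensorCounit counitA counit (a ⊗ₜ h) = counitA a * counit h := by
  simp [tensorCounit]

theorem braiding_tmul (a b : A) :
    braiding β α coact α act (a ⊗ₜ b) =
      sweedler (coact a) fun x y => act (β (β x) ⊗ₜ α.symm b) ⊗ₜ[K] α.symm y := by
  simp only [braiding, LinearMap.comp_apply, LinearEquiv.coe_coe, LinearMap.rTensor_tmul]
  conv_lhs => rw [eq_sweedler (coact a)]
  simp only [sweedler_tmul_left, map_sweedler_equiv, map_sweedler, TensorProduct.rightComm_tmul,
    TensorProduct.map_tmul, LinearEquiv.coe_coe, LinearMap.comp_apply, pow_two,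
    LinearEquiv.mul_apply]

theorem braidedMul_eq_sweedler (s t : A ⊗[K] A) :
    braidedMul β α mulA act coact (s ⊗ₜ t) =
      sweedler s fun a₁ a₂ => sweedler t fun b₁ b₂ => sweedler (coact a₂) fun x y =>
        mulA (a₁ ⊗ₜ act (β (β x) ⊗ₜ α.symm b₁)) ⊗ₜ[K] mulA (α.symm y ⊗ₜ b₂) := by
  conv_lhs => rw [eq_sweedler s, eq_sweedler t]
  simp (disch := fun_prop) only [braidedMul, LinearMap.comp_apply, sweedler_tmul_left,
    tmul_sweedler_right, map_sweedler, middle_tmul, braiding_tmul, sweedler_sweedler,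
    sweedler_tmul, TensorProduct.map_tmul]
  exact sweedler_comm t s _

theorem tensorAct_tmul (actM : H ⊗[K] M →ₗ[K] M) (actN : H ⊗[K] N →ₗ[K] N) (h : H)
    (t : M ⊗[K] N) :
    tensorAct comul actM actN (h ⊗ₜ t) = sweedler (comul h) fun x y => sweedler t fun m n =>
      actM (x ⊗ₜ m) ⊗ₜ[K] actN (y ⊗ₜ n) := by
  simp only [tensorAct, LinearMap.comp_apply, LinearEquiv.coe_coe, LinearMap.rTensor_tmul]
  conv_lhs => rw [eq_sweedler (comul h), eq_sweedler t]
  simp only [sweedler_tmul_left, tmul_sweedler_right, map_sweedler_equiv, map_sweedler,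
    TensorProduct.tensorTensorTensorComm_tmul, TensorProduct.map_tmul]
  exact sweedler_comm t _ _

theorem codiagonal_eq_sweedler (coactM : M →ₗ[K] H ⊗[K] M) (coactN : N →ₗ[K] H ⊗[K] N)
    (t : M ⊗[K] N) :
    codiagonal mul coactM coactN t = sweedler t fun m n => sweedler (coactM m) fun x y =>
      sweedler (coactN n) fun z w => mul (x ⊗ₜ z) ⊗ₜ[K] (y ⊗ₜ[K] w) := by
  conv_lhs => rw [eq_sweedler t]
  simp only [codiagonal, map_sweedler, LinearMap.comp_apply, LinearEquiv.coe_coe,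
    TensorProduct.map_tmul]
  refine congrArg _ (funext₂ fun m n => ?_)
  conv_lhs => rw [eq_sweedler (coactM m), eq_sweedler (coactN n)]
  simp only [sweedler_tmul_left, tmul_sweedler_right, map_sweedler_equiv, map_sweedler,
    TensorProduct.tensorTensorTensorComm_tmul, LinearMap.rTensor_tmul]
  exact sweedler_comm _ _ _

theorem map_tensorTensorTensorComm_eq_sweedler (f g : H →ₗ[K] H) (s : H ⊗[K] H) (t : H ⊗[K] M)
    (actM : H ⊗[K] M →ₗ[K] M) :
    TensorProduct.map mul actM (TensorProduct.tensorTensorTensorComm K H H H M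
        (f.lTensor H s ⊗ₜ[K] g.rTensor M t)) =
      sweedler s fun h₁ h₂ => sweedler t fun x y =>
        mul (h₁ ⊗ₜ g x) ⊗ₜ[K] actM (f h₂ ⊗ₜ y) := by
  simp only [lTensor_eq_sweedler, rTensor_eq_sweedler, sweedler_tmul_left, tmul_sweedler_right,
    map_sweedler_equiv, map_sweedler, TensorProduct.tensorTensorTensorComm_tmul,
    TensorProduct.map_tmul]
  exact sweedler_comm t s _

theorem rTensor_rightComm_eq_sweedler (f : H →ₗ[K] H ⊗[K] M) (s : H ⊗[K] H) :
    mul.rTensor M (TensorProduct.rightComm K H M H (f.rTensor H s)) =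
      sweedler s fun h₁ h₂ => sweedler (f h₁) fun x y => mul (x ⊗ₜ h₂) ⊗ₜ[K] y := by
  rw [rTensor_eq_sweedler f, map_sweedler_equiv, map_sweedler]
  refine congrArg _ (funext₂ fun h₁ h₂ => ?_)
  conv_lhs => rw [eq_sweedler (f h₁)]
  simp only [sweedler_tmul_left, map_sweedler_equiv, map_sweedler, TensorProduct.rightComm_tmul,
    LinearMap.rTensor_tmul]

end Formulas

/-! ### Radford's theorem for ordinary bialgebras -/

section Radford

variable {K : Type*} [Field K]
variable {H : Type*} [AddCommGroup H] [Module K H]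
variable {A : Type*} [AddCommGroup A] [Module K A]
variable {mul : H ⊗[K] H →ₗ[K] H} {one : H} {comul : H →ₗ[K] H ⊗[K] H} {counit : H →ₗ[K] K}
variable {mulA : A ⊗[K] A →ₗ[K] A} {oneA : A} {comulA : A →ₗ[K] A ⊗[K] A} {counitA : A →ₗ[K] K}
variable {act : H ⊗[K] A →ₗ[K] A} {coact : A →ₗ[K] H ⊗[K] A}

local notation:70 x:70 " ⋆ " y:71 => mul (x ⊗ₜ[K] y)
local notation:70 x:70 " ⋄ " y:71 => mulA (x ⊗ₜ[K] y)
local notation:72 x:73 " ▷ " y:72 => act (x ⊗ₜ[K] y)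
-- The smash product, smash coproduct and counit of the ordinary biproduct, that is, with identity
-- automorphisms.
local notation "μ" => smashMul (LinearEquiv.refl K H) mul comul (LinearEquiv.refl K A) mulA act
local notation "δ" =>
  smashComul (LinearEquiv.refl K H) mul comul (LinearEquiv.refl K A) comulA coact
local notation "ε" => tensorCounit counitA counit

theorem smashMul_refl_tmul (a b : A) (h g : H) :
    μ ((a ⊗ₜ h) ⊗ₜ (b ⊗ₜ g)) = sweedler (comul h) fun x y => (a ⋄ (x ▷ b)) ⊗ₜ[K] (y ⋆ g) := by
  simp only [smashMul_tmul, LinearEquiv.refl_symm, LinearEquiv.refl_apply]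

theorem smashComul_refl_tmul (a : A) (h : H) :
    δ (a ⊗ₜ h) = sweedler (comulA a) fun a₁ a₂ => sweedler (coact a₂) fun x y =>
      sweedler (comul h) fun h₁ h₂ => (a₁ ⊗ₜ[K] (x ⋆ h₁)) ⊗ₜ[K] (y ⊗ₜ[K] h₂) := by
  simp only [smashComul_tmul, LinearEquiv.refl_symm, LinearEquiv.refl_apply]

namespace IsBiproductDatum
variable (D : IsBiproductDatum mul one comul counit mulA oneA comulA counitA act coact)
include D

theorem smashMul_assoc (x y z : A ⊗[K] H) : μ (x ⊗ₜ μ (y ⊗ₜ z)) = μ (μ (x ⊗ₜ y) ⊗ₜ z) := by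
  revert x; refine eq_of_tmul (by fun_prop) (by fun_prop) fun a h => ?_
  revert y; refine eq_of_tmul (by fun_prop) (by fun_prop) fun b g => ?_
  revert z; refine eq_of_tmul (by fun_prop) (by fun_prop) fun c k => ?_
  simp (disch := fun_prop) only [smashMul_refl_tmul, tmul_sweedler_right, sweedler_tmul_left,
    map_sweedler, D.comul_mul, sweedler_sweedler, sweedler_tmul, D.act_mul, D.act_act, D.mul_assoc,
    D.mulA_assoc]
  simp (disch := fun_prop) only [sweedler_comm (comul g), D.sweedler_coassoc]

theorem smashMul_one (x : A ⊗[K] H) : μ (x ⊗ₜ (oneA ⊗ₜ one)) = x := by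
  revert x; refine eq_of_tmul (by fun_prop) (by fun_prop) fun a h => ?_
  simp (disch := fun_prop) only [smashMul_refl_tmul, D.act_one, D.mul_one, TensorProduct.tmul_smul,
    map_smul, D.mul_oneA, ← TensorProduct.smul_tmul', D.sweedler_counit_left]

theorem one_smashMul (x : A ⊗[K] H) : μ ((oneA ⊗ₜ one) ⊗ₜ x) = x := by
  revert x; refine eq_of_tmul (by fun_prop) (by fun_prop) fun a h => ?_
  simp (disch := fun_prop) only [smashMul_refl_tmul, D.comul_one, sweedler_tmul, D.one_act,
    D.one_mul, D.oneA_mul]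

theorem smashComul_coassoc (x : A ⊗[K] H) :
    TensorProduct.map LinearMap.id δ (δ x) =
      TensorProduct.assoc K _ _ _ (TensorProduct.map δ LinearMap.id (δ x)) := by
  revert x; refine eq_of_tmul (by fun_prop) (by fun_prop) fun a h => ?_
  simp (disch := fun_prop) only [map_eq_sweedler, smashComul_refl_tmul, sweedler_sweedler,
    sweedler_tmul, LinearMap.id_apply, tmul_sweedler_right, sweedler_tmul_left,
    map_sweedler_equiv, TensorProduct.assoc_tmul, D.comul_mul]
  simp (disch := fun_prop) only [sweedler_comm (comul _) (comulA _),
    sweedler_comm (comul _) (coact _), sweedler_comm (coact _) (comulA _),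
    D.sweedler_coact_comul, D.sweedler_coact_coact, D.sweedler_coassocA, D.sweedler_coassoc,
    D.mul_assoc]
  refine congrArg _ (funext₂ fun a' a₃ => congrArg _ (funext₂ fun a₁ a₂ => ?_))
  rw [sweedler_comm (coact a₃)]
  refine congrArg _ (funext₂ fun x₂ y₂ => congrArg _ (funext₂ fun x₃ y₃ => ?_))
  rw [sweedler_comm (comul h) (comul x₃)]

theorem smashComul_counit_left (x : A ⊗[K] H) :
    TensorProduct.lid K _ (LinearMap.rTensor _ ε (δ x)) = x := by
  revert x; refine eq_of_tmul (by fun_prop) (by fun_prop) fun a h => ?_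
  simp (disch := fun_prop) only [rTensor_eq_sweedler, smashComul_refl_tmul, sweedler_sweedler,
    sweedler_tmul, tensorCounit_tmul, map_sweedler_equiv, TensorProduct.lid_tmul, D.counit_mul,
    mul_smul, ← smul_sweedler, D.sweedler_counit_left, D.sweedler_counit_coact,
    D.sweedler_counitA_left]

theorem smashComul_counit_right (x : A ⊗[K] H) :
    TensorProduct.rid K _ (LinearMap.lTensor _ ε (δ x)) = x := by
  revert x; refine eq_of_tmul (by fun_prop) (by fun_prop) fun a h => ?_
  simp (disch := fun_prop) only [lTensor_eq_sweedler, smashComul_refl_tmul, sweedler_sweedler,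
    sweedler_tmul, tensorCounit_tmul, map_sweedler_equiv, TensorProduct.rid_tmul,
    mul_smul, ← smul_sweedler, D.sweedler_counit_right, D.sweedler_coact_counit,
    D.sweedler_counitA_right, D.one_mul]

variable (P : IsBraidedBialgebra mul one comul counit mulA oneA comulA counitA act coact)
include P

/-- The smash coproduct is multiplicative: the conditions on `A` expand `Δ((a ⊗ h)(b ⊗ g))`, and the
Yetter-Drinfeld condition moves the components of `h` past the coaction of `b`. -/
theorem smashComul_smashMul (x y : A ⊗[K] H) :
    δ (μ (x ⊗ₜ y)) = tensorMul μ μ (δ x ⊗ₜ δ y) := by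
  revert x; refine eq_of_tmul (by fun_prop) (by fun_prop) fun a h => ?_
  revert y; refine eq_of_tmul (by fun_prop) (by fun_prop) fun b g => ?_
  simp (disch := fun_prop) only [smashMul_refl_tmul, map_sweedler, smashComul_refl_tmul,
    tensorMul_eq_sweedler, sweedler_sweedler, sweedler_tmul, P.comul_mul, P.comul_act, P.coact_mul,
    D.comul_mul, tmul_sweedler_right, sweedler_tmul_left, D.act_act, D.mul_assoc]
  simp (disch := fun_prop) only [sweedler_comm (comul _) (comulA _),
    sweedler_comm (comul _) (coact _), sweedler_comm (coact _) (comulA _),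
    D.sweedler_coact_coact]
  rw [sweedler_comm (comulA b)]
  refine congrArg _ (funext₂ fun a₁ a₂ => congrArg _ (funext₂ fun b₁ b₂ => ?_))
  rw [sweedler_comm (coact b₂)]
  refine congrArg _ (funext₂ fun u v => ?_)
  -- All factors not involving `h` and the coaction of `b₂` are absorbed into the summand.
  have key (u₁ u₂ : H) := D.sweedler_compat P h b₂
    (f := fun p z t q => sweedler (comul g) fun g₁ g₂ =>
      ((a₁ ⋄ ((u₁ ⋆ p) ▷ b₁)) ⊗ₜ[K] (u₂ ⋆ z ⋆ g₁)) ⊗ₜ[K] ((v ⋄ t) ⊗ₜ[K] (q ⋆ g₂)))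
    (by fun_prop) (by fun_prop) (by fun_prop) (by fun_prop)
  simp only [D.mul_assoc] at key
  rw [sweedler_comm (comul h)]
  simp only [key]
  simp only [sweedler_comm (comul _) (coact b₂), sweedler_comm (comul g) (comul _),
    sweedler_comm (comul _) (comul u)]
  refine congrArg _ (funext₂ fun z w => congrArg _ (funext₂ fun u₁ u₂ =>
    congrArg _ (funext₂ fun x y => ?_)))
  rw [sweedler_comm (comul x)]


/-- The biproduct of a bialgebra in Yetter-Drinfeld modules is a bialgebra. -/
theorem isHomBialgebra_smash :
    IsHomBialgebra (LinearEquiv.refl K (A ⊗[K] H)) μ (oneA ⊗ₜ[K] one) δ ε where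
  algebra :=
    { map_mul := fun _ _ => rfl
      map_one := rfl
      hom_assoc := D.smashMul_assoc
      mul_one := D.smashMul_one
      one_mul := D.one_smashMul }
  coalgebra :=
    { comul_map := fun x => by simp
      counit_map := fun _ => rfl
      hom_coassoc := D.smashComul_coassoc
      counit_left := D.smashComul_counit_left
      counit_right := D.smashComul_counit_right }
  comul_mul := D.smashComul_smashMul P
  comul_one := by
    simp (disch := fun_prop) only [smashComul_refl_tmul, P.comul_one, P.coact_one, D.comul_one,
      sweedler_tmul, D.one_mul]
  counit_mul := fun x y => by
    revert x; refine eq_of_tmul (by fun_prop) (by fun_prop) fun a h => ?_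
    revert y; refine eq_of_tmul (by fun_prop) (by fun_prop) fun b g => ?_
    have := D.sweedler_counit_left h
      (f := fun y => counitA a * counitA b * (counit y * counit g)) (by fun_prop)
    simp only [smashMul_refl_tmul, map_sweedler, tensorCounit_tmul, P.counit_mul, P.counit_act,
      D.counit_mul, smul_eq_mul] at this ⊢
    refine Eq.trans (congrArg _ (funext₂ fun x y => ?_)) (this.trans ?_) <;> ring
  counit_one := by rw [tensorCounit_tmul, P.counit_one, D.counit_one, _root_.one_mul]

omit P

/-- If the counit of `A ⊗ H` is an algebra map, then `ε_A` is an `H`-linear algebra map. -/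
theorem counitA_of_smash
    (B : IsHomBialgebra (LinearEquiv.refl K (A ⊗[K] H)) μ (oneA ⊗ₜ[K] one) δ ε) :
    counitA oneA = 1 ∧ (∀ a b, counitA (a ⋄ b) = counitA a * counitA b) ∧
      ∀ h a, counitA (h ▷ a) = counit h * counitA a := by
  refine ⟨?_, fun a b => ?_, fun h a => ?_⟩
  · simpa only [tensorCounit_tmul, D.counit_one, _root_.mul_one] using B.counit_one
  · have := B.counit_mul (a ⊗ₜ one) (b ⊗ₜ one)
    simpa (disch := fun_prop) only [smashMul_refl_tmul, D.comul_one, sweedler_tmul, D.one_act,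
      D.one_mul, tensorCounit_tmul, D.counit_one, _root_.mul_one] using this
  · have := B.counit_mul (oneA ⊗ₜ h) (a ⊗ₜ one)
    have h1 : counitA oneA = 1 := by
      simpa only [tensorCounit_tmul, D.counit_one, _root_.mul_one] using B.counit_one
    have h2 := D.sweedler_counit_right h (f := fun x => counitA (x ▷ a)) (by fun_prop)
    simp only [smashMul_refl_tmul, map_sweedler, D.oneA_mul, D.mul_one, tensorCounit_tmul, h1,
      D.counit_one, _root_.mul_one, _root_.one_mul] at this
    rw [← this, ← h2]
    simp only [smul_eq_mul, _root_.mul_comm]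

/-- If the biproduct is a bialgebra, then `A` is a bialgebra in Yetter-Drinfeld modules. Each of the
four Sweedler identities is the multiplicativity of `Δ` on a product `(a ⊗ 1)(b ⊗ 1)` or
`(1 ⊗ h)(a ⊗ 1)`, pushed forward along `p ⊗ p` or `q ⊗ p`, where `p = id ⊗ ε_H` and
`q = ε_A ⊗ id` are the projections of `A ⊗ H` onto `A` and `H`. -/
theorem isBraidedBialgebra_of_smash
    (B : IsHomBialgebra (LinearEquiv.refl K (A ⊗[K] H)) μ (oneA ⊗ₜ[K] one) δ ε) :
    IsBraidedBialgebra mul one comul counit mulA oneA comulA counitA act coact := by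
  obtain ⟨counit_one, counit_mul, counit_act⟩ := D.counitA_of_smash B
  let p : A ⊗[K] H →ₗ[K] A := (TensorProduct.rid K A).toLinearMap ∘ₗ counit.lTensor A
  let q : A ⊗[K] H →ₗ[K] H := (TensorProduct.lid K H).toLinearMap ∘ₗ counitA.rTensor H
  have hp (a : A) (h : H) : p (a ⊗ₜ h) = counit h • a := by simp [p]
  have hq (a : A) (h : H) : q (a ⊗ₜ h) = counitA a • h := by simp [q]
  have p_smul (a b : A) (h g : H) : p (μ ((a ⊗ₜ h) ⊗ₜ (b ⊗ₜ g))) = counit g • (a ⋄ (h ▷ b)) := by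
    simp (disch := fun_prop) only [smashMul_refl_tmul, map_sweedler, hp, D.counit_mul, mul_smul,
      D.sweedler_counit_right]
  have q_smul (a b : A) (h g : H) :
      q (μ ((a ⊗ₜ h) ⊗ₜ (b ⊗ₜ g))) = counitA a • counitA b • (h ⋆ g) := by
    have := D.sweedler_counit_left h (f := fun y => (counitA a * counitA b) • (y ⋆ g))
      (by fun_prop)
    simp only [smashMul_refl_tmul, map_sweedler, hq, counit_mul, counit_act, smul_smul] at this ⊢
    rw [← this]
    exact congrArg _ (funext₂ fun x y => by congr 1; ring)
  have pp_comul (a : A) (h : H) :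
      TensorProduct.map p p (δ (a ⊗ₜ h)) = counit h • comulA a := by
    simp (disch := fun_prop) only [smashComul_refl_tmul, map_sweedler, TensorProduct.map_tmul, hp,
      D.counit_mul, mul_smul, TensorProduct.tmul_smul, ← TensorProduct.smul_tmul',
      ← smul_sweedler, D.sweedler_counit_right, D.sweedler_counit_coact]
    exact congrArg _ (eq_sweedler _).symm
  have qp_comul (a : A) (h : H) :
      TensorProduct.map q p (δ (a ⊗ₜ h)) = sweedler (coact a) fun x y => (x ⋆ h) ⊗ₜ[K] y := by
    simp (disch := fun_prop) only [smashComul_refl_tmul, map_sweedler, TensorProduct.map_tmul, hp,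
      hq, TensorProduct.tmul_smul, ← TensorProduct.smul_tmul', ← smul_sweedler,
      D.sweedler_counit_right, D.sweedler_counitA_left]
  have mul_A (a b : A) : μ ((a ⊗ₜ one) ⊗ₜ (b ⊗ₜ one)) = (a ⋄ b) ⊗ₜ one := by
    simp (disch := fun_prop) only [smashMul_refl_tmul, D.comul_one, sweedler_tmul, D.one_act,
      D.mul_one]
  have mul_HA (h : H) (a : A) :
      μ ((oneA ⊗ₜ h) ⊗ₜ (a ⊗ₜ one)) = sweedler (comul h) fun x y => (x ▷ a) ⊗ₜ y := by
    simp (disch := fun_prop) only [smashMul_refl_tmul, D.oneA_mul, D.mul_one]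
  have comul_A (a : A) : δ (a ⊗ₜ one) = sweedler (comulA a) fun a₁ a₂ => sweedler (coact a₂)
      fun x y => (a₁ ⊗ₜ[K] x) ⊗ₜ[K] (y ⊗ₜ[K] one) := by
    simp (disch := fun_prop) only [smashComul_refl_tmul, D.comul_one, sweedler_tmul, D.mul_one]
  have comul_one : comulA oneA = oneA ⊗ₜ oneA := by
    have := congrArg (TensorProduct.map p p) B.comul_one
    simpa only [pp_comul, TensorProduct.map_tmul, hp, D.counit_one, one_smul] using this
  have coact_one : coact oneA = one ⊗ₜ oneA := by
    have := congrArg (TensorProduct.map q p) B.comul_one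
    simp only [qp_comul, TensorProduct.map_tmul, hp, hq, D.counit_one, counit_one, one_smul,
      D.mul_one] at this
    exact (eq_sweedler _).trans this
  have comul_H (h : H) : δ (oneA ⊗ₜ h) = sweedler (comul h)
      fun x y => (oneA ⊗ₜ[K] x) ⊗ₜ[K] (oneA ⊗ₜ[K] y) := by
    simp (disch := fun_prop) only [smashComul_refl_tmul, comul_one, coact_one, sweedler_tmul,
      D.one_mul]
  refine ⟨fun a b => ?_, comul_one, counit_mul, counit_one, fun a b => ?_, coact_one,
    fun h a => ?_, counit_act, fun h a => ?_⟩
  · have := congrArg (TensorProduct.map p p) (B.comul_mul (a ⊗ₜ one) (b ⊗ₜ one))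
    rw [mul_A, pp_comul] at this
    simp (disch := fun_prop) only [comul_A, tensorMul_eq_sweedler, sweedler_sweedler,
      sweedler_tmul, map_sweedler, TensorProduct.map_tmul, p_smul, D.counit_one, one_smul,
      D.one_act, ← TensorProduct.smul_tmul', D.sweedler_counit_coact] at this
    exact this
  · have := congrArg (TensorProduct.map q p) (B.comul_mul (a ⊗ₜ one) (b ⊗ₜ one))
    rw [mul_A, qp_comul] at this
    simp (disch := fun_prop) only [comul_A, tensorMul_eq_sweedler, sweedler_sweedler,
      sweedler_tmul, map_sweedler, TensorProduct.map_tmul, p_smul, q_smul, D.counit_one,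
      one_smul, D.mul_one, D.one_act,
      ← TensorProduct.smul_tmul', ← smul_sweedler, D.sweedler_counitA_left] at this
    exact (eq_sweedler _).trans this
  · have := congrArg (TensorProduct.map p p) (B.comul_mul (oneA ⊗ₜ h) (a ⊗ₜ one))
    simp only [mul_HA, map_sweedler, pp_comul] at this
    simp (disch := fun_prop) only [comul_H, comul_A, tensorMul_eq_sweedler, sweedler_sweedler,
      sweedler_tmul, map_sweedler, TensorProduct.map_tmul, p_smul, D.counit_one, one_smul,
      D.oneA_mul, ← TensorProduct.smul_tmul', D.sweedler_counit_coact,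
      D.sweedler_counit_right] at this
    exact this
  · have := congrArg (TensorProduct.map q p) (B.comul_mul (oneA ⊗ₜ h) (a ⊗ₜ one))
    simp only [mul_HA, map_sweedler, qp_comul] at this
    simp (disch := fun_prop) only [comul_H, comul_A, tensorMul_eq_sweedler, sweedler_sweedler,
      sweedler_tmul, map_sweedler, TensorProduct.map_tmul, p_smul, q_smul, D.counit_one,
      counit_one, one_smul, D.oneA_mul,
      ← TensorProduct.smul_tmul', ← smul_sweedler, D.sweedler_counitA_left] at this
    exact this.symm

end IsBiproductDatum
end Radford

/-! ### Twisting a bialgebra by an automorphism -/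

section Twist

variable {K : Type*} [Field K] {C : Type*} [AddCommGroup C] [Module K C]

/-- Yau's twisting principle: for an automorphism `γ` of `(C, m, u, d, e)`, the twisted maps `γ ∘ m`
and `d ∘ γ` form a Hom-bialgebra with structure map `γ` if and only if `m` and `d` form an ordinary
bialgebra, because each Hom-axiom is the image of the ordinary one under an automorphism of a
tensor power of `C`. -/
theorem isHomBialgebra_twist_iff {γ : C ≃ₗ[K] C} {m : C ⊗[K] C →ₗ[K] C} {u : C}
    {d : C →ₗ[K] C ⊗[K] C} {e : C →ₗ[K] K}
    (hm : ∀ x y, γ (m (x ⊗ₜ y)) = m (γ x ⊗ₜ γ y)) (hu : γ u = u)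
    (hd : ∀ x, d (γ x) = TensorProduct.map γ.toLinearMap γ.toLinearMap (d x))
    (he : ∀ x, e (γ x) = e x) :
    IsHomBialgebra γ (γ.toLinearMap ∘ₗ m) u (d ∘ₗ γ.toLinearMap) e ↔
      IsHomBialgebra (LinearEquiv.refl K C) m u d e := by
  have assoc_iff (x y z : C) :
      (γ.toLinearMap ∘ₗ m) (γ x ⊗ₜ (γ.toLinearMap ∘ₗ m) (y ⊗ₜ z)) =
        (γ.toLinearMap ∘ₗ m) ((γ.toLinearMap ∘ₗ m) (x ⊗ₜ y) ⊗ₜ γ z) ↔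
      m (x ⊗ₜ m (y ⊗ₜ z)) = m (m (x ⊗ₜ y) ⊗ₜ z) := by
    simp only [LinearMap.comp_apply, LinearEquiv.coe_coe, ← hm, EmbeddingLike.apply_eq_iff_eq]
  let Γ := TensorProduct.congr γ γ
  have hΓ (x y : C) : Γ (x ⊗ₜ y) = γ x ⊗ₜ γ y := rfl
  have coassoc_iff (x : C) :
      TensorProduct.map γ.toLinearMap (d ∘ₗ γ.toLinearMap) ((d ∘ₗ γ.toLinearMap) x) =
        TensorProduct.assoc K C C C
          (TensorProduct.map (d ∘ₗ γ.toLinearMap) γ.toLinearMap ((d ∘ₗ γ.toLinearMap) x)) ↔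
      TensorProduct.map LinearMap.id d (d (γ x)) =
        TensorProduct.assoc K C C C (TensorProduct.map d LinearMap.id (d (γ x))) := by
    have dΓ (y : C) : d (γ y) = Γ (d y) := hd y
    have hl : TensorProduct.map γ.toLinearMap (d ∘ₗ γ.toLinearMap) (d (γ x)) =
        TensorProduct.congr γ Γ (TensorProduct.map LinearMap.id d (d (γ x))) := by
      simp only [map_eq_sweedler, map_sweedler_equiv, TensorProduct.congr_tmul,
        LinearMap.comp_apply, LinearEquiv.coe_coe, dΓ, LinearMap.id_apply]
    have hr : TensorProduct.assoc K C C C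
          (TensorProduct.map (d ∘ₗ γ.toLinearMap) γ.toLinearMap (d (γ x))) =
        TensorProduct.congr γ Γ (TensorProduct.assoc K C C C
          (TensorProduct.map d LinearMap.id (d (γ x)))) := by
      simp only [map_eq_sweedler, map_sweedler_equiv, LinearMap.comp_apply, LinearEquiv.coe_coe,
        dΓ, LinearMap.id_apply]
      refine congrArg _ (funext₂ fun y z => ?_)
      exact eq_of_tmul (f := fun t => TensorProduct.assoc K C C C (Γ t ⊗ₜ γ z))
        (g := fun t => TensorProduct.congr γ Γ (TensorProduct.assoc K C C C (t ⊗ₜ z)))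
        (by fun_prop) (by fun_prop) (fun _ _ => rfl) (d y)
    rw [LinearMap.comp_apply, LinearEquiv.coe_coe, hl, hr,
      (TensorProduct.congr γ Γ).injective.eq_iff]
  have comul_mul_iff (x y : C) :
      (d ∘ₗ γ.toLinearMap) ((γ.toLinearMap ∘ₗ m) (x ⊗ₜ y)) =
        tensorMul (γ.toLinearMap ∘ₗ m) (γ.toLinearMap ∘ₗ m)
          ((d ∘ₗ γ.toLinearMap) x ⊗ₜ (d ∘ₗ γ.toLinearMap) y) ↔
      d (m (x ⊗ₜ y)) = tensorMul m m (d x ⊗ₜ d y) := by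
    have hl : d (γ (γ (m (x ⊗ₜ y)))) = Γ (Γ (d (m (x ⊗ₜ y)))) := by
      rw [hd, hd]
      rfl
    have hr : tensorMul (γ.toLinearMap ∘ₗ m) (γ.toLinearMap ∘ₗ m) (d (γ x) ⊗ₜ d (γ y)) =
        Γ (Γ (tensorMul m m (d x ⊗ₜ d y))) := by
      simp (disch := fun_prop) only [LinearMap.comp_apply, LinearEquiv.coe_coe, hd,
        tensorMul_eq_sweedler, sweedler_map, map_sweedler_equiv, hΓ, hm]
    simp only [LinearMap.comp_apply, LinearEquiv.coe_coe]
    rw [hl, hr, Γ.injective.eq_iff, Γ.injective.eq_iff]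
  constructor
  · rintro ⟨⟨-, h1, h2, h3, h4⟩, ⟨-, -, h5, h6, h7⟩, h8, h9, h10, h11⟩
    refine ⟨⟨fun _ _ => rfl, rfl, fun x y z => (assoc_iff x y z).1 (h2 x y z),
        fun x => γ.injective (h3 x), fun x => γ.injective (h4 x)⟩,
      ⟨fun x => by simp, fun _ => rfl, fun x => ?_, fun x => ?_, fun x => ?_⟩,
      fun x y => (comul_mul_iff x y).1 (h8 x y), ?_, fun x y => ?_, h11⟩
    · obtain ⟨x, rfl⟩ := γ.surjective x
      exact (coassoc_iff x).1 (h5 x)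
    · obtain ⟨x, rfl⟩ := γ.surjective x
      exact h6 x
    · obtain ⟨x, rfl⟩ := γ.surjective x
      exact h7 x
    · simpa only [LinearMap.comp_apply, LinearEquiv.coe_coe, hu] using h9
    · simpa only [LinearMap.comp_apply, LinearEquiv.coe_coe, he] using h10 x y
  · rintro ⟨⟨-, -, h2, h3, h4⟩, ⟨-, -, h5, h6, h7⟩, h8, h9, h10, h11⟩
    refine ⟨⟨fun x y => congrArg γ (hm x y), hu, fun x y z => (assoc_iff x y z).2 (h2 x y z),
        fun x => congrArg γ (h3 x), fun x => congrArg γ (h4 x)⟩,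
      ⟨fun x => hd _, he, fun x => (coassoc_iff x).2 (h5 _), fun x => h6 _, fun x => h7 _⟩,
      fun x y => (comul_mul_iff x y).2 (h8 x y), ?_, fun x y => ?_, h11⟩
    · simpa only [LinearMap.comp_apply, LinearEquiv.coe_coe, hu] using h9
    · simpa only [LinearMap.comp_apply, LinearEquiv.coe_coe, he] using h10 x y

end Twist

/-! ### Untwisting the Hom-structures -/

section Untwisting

variable {K : Type*} [Field K]
variable {H : Type*} [AddCommGroup H] [Module K H]
variable {A : Type*} [AddCommGroup A] [Module K A]
variable {β : H ≃ₗ[K] H}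
variable {mul : H ⊗[K] H →ₗ[K] H} {one : H} {comul : H →ₗ[K] H ⊗[K] H} {counit : H →ₗ[K] K}
variable {α : A ≃ₗ[K] A}
variable {mulA : A ⊗[K] A →ₗ[K] A} {oneA : A} {comulA : A →ₗ[K] A ⊗[K] A} {counitA : A →ₗ[K] K}
variable {act : H ⊗[K] A →ₗ[K] A} {coact : A →ₗ[K] H ⊗[K] A}

variable (β mul one comul counit α mulA oneA comulA counitA act coact) in
/-- The pair `(β, α)` is an automorphism of all the structure maps of `H` and `A`. -/
structure IsAutomorphismPair : Prop where
  map_mul : ∀ x y, β (mul (x ⊗ₜ y)) = mul (β x ⊗ₜ β y)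
  map_one : β one = one
  map_comul : ∀ x, comul (β x) = TensorProduct.map β.toLinearMap β.toLinearMap (comul x)
  map_counit : ∀ x, counit (β x) = counit x
  map_mulA : ∀ x y, α (mulA (x ⊗ₜ y)) = mulA (α x ⊗ₜ α y)
  map_oneA : α oneA = oneA
  map_comulA : ∀ x, comulA (α x) = TensorProduct.map α.toLinearMap α.toLinearMap (comulA x)
  map_counitA : ∀ x, counitA (α x) = counitA x
  map_act : ∀ h a, α (act (h ⊗ₜ a)) = act (β h ⊗ₜ α a)
  map_coact : ∀ a, coact (α a) = TensorProduct.map β.toLinearMap α.toLinearMap (coact a)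

-- The twisted structure maps.
local notation "mul'" => LinearMap.comp (LinearEquiv.toLinearMap β) mul
local notation "comul'" => LinearMap.comp comul (LinearEquiv.toLinearMap β)
local notation "mulA'" => LinearMap.comp (LinearEquiv.toLinearMap α) mulA
local notation "comulA'" => LinearMap.comp comulA (LinearEquiv.toLinearMap α)
local notation "act'" => LinearMap.comp (LinearEquiv.toLinearMap α) act
local notation "coact'" => LinearMap.comp coact (LinearEquiv.toLinearMap α)

theorem isAutomorphismPair_of_twist
    (hH : IsHomBialgebra β mul' one comul' counit)
    (hact : IsModuleHomAlgebra β mul' one comul' counit α mulA' oneA act')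
    (hcoact : IsComoduleHomCoalgebra β mul' one comul' counit α comulA' counitA coact') :
    IsAutomorphismPair β mul one comul counit α mulA oneA comulA counitA act coact where
  map_mul x y := β.injective (hH.algebra.map_mul x y)
  map_one := hH.algebra.map_one
  map_comul x := by
    obtain ⟨x, rfl⟩ := β.surjective x
    exact hH.coalgebra.comul_map x
  map_counit := hH.coalgebra.counit_map
  map_mulA x y := α.injective (hact.algebra.map_mul x y)
  map_oneA := hact.algebra.map_one
  map_comulA x := by
    obtain ⟨x, rfl⟩ := α.surjective x
    exact hcoact.coalgebra.comul_map x
  map_counitA := hcoact.coalgebra.counit_map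
  map_act h a := α.injective (hact.module.map_act h a)
  map_coact x := by
    obtain ⟨x, rfl⟩ := α.surjective x
    exact hcoact.comodule.coact_map x

variable (E : IsAutomorphismPair β mul one comul counit α mulA oneA comulA counitA act coact)
include E
variable (hβ : ∀ h : H, β (β h) = h)
include hβ

/-- The untwisted maps of a module Hom-algebra and comodule Hom-coalgebra satisfy the ordinary laws.
Each law is the Hom-law at arguments moved by powers of `α` and `β`, or its image under inverse
powers; `β² = id` makes the surplus powers of `β` match. -/
theorem isBiproductDatum_of_twist
    (hH : IsHomBialgebra β mul' one comul' counit)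
    (hact : IsModuleHomAlgebra β mul' one comul' counit α mulA' oneA act')
    (hcoact : IsComoduleHomCoalgebra β mul' one comul' counit α comulA' counitA coact') :
    IsBiproductDatum mul one comul counit mulA oneA comulA counitA act coact := by
  have B := (isHomBialgebra_twist_iff E.map_mul E.map_one E.map_comul E.map_counit).1 hH
  have β2 (x : H) : (β ^ 2) x = x := by rw [pow_two]; exact hβ x
  constructor
  case mul_assoc => exact B.algebra.hom_assoc
  case one_mul => exact B.algebra.one_mul
  case mul_one => exact B.algebra.mul_one
  case coassoc =>
    intro h
    have := congrArg (fun T => sweedler T fun x r => sweedler r fun y z => x ⊗ₜ[K] (y ⊗ₜ[K] z))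
      (B.coalgebra.hom_coassoc h)
    simpa (disch := fun_prop) only [sweedler_map, map_eq_sweedler, map_sweedler_equiv,
      sweedler_assoc_tmul, sweedler_sweedler, sweedler_tmul, LinearEquiv.coe_coe,
      LinearEquiv.refl_apply] using this
  case counit_left =>
    intro h
    simpa only [rTensor_eq_sweedler, map_sweedler_equiv, TensorProduct.lid_tmul,
      LinearEquiv.refl_apply] using B.coalgebra.counit_left h
  case counit_right =>
    intro h
    simpa only [lTensor_eq_sweedler, map_sweedler_equiv, TensorProduct.rid_tmul,
      LinearEquiv.refl_apply] using B.coalgebra.counit_right h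
  case comul_mul =>
    intro x y
    simpa only [tensorMul_eq_sweedler] using B.comul_mul x y
  case comul_one => exact B.comul_one
  case counit_mul => exact B.counit_mul
  case counit_one => exact B.counit_one
  case mulA_assoc =>
    intro a b c
    have := hact.algebra.hom_assoc a b c
    simpa only [LinearMap.comp_apply, LinearEquiv.coe_coe, ← E.map_mulA,
      EmbeddingLike.apply_eq_iff_eq] using this
  case oneA_mul => exact fun a => α.injective (hact.algebra.one_mul a)
  case mul_oneA => exact fun a => α.injective (hact.algebra.mul_one a)
  case act_act =>
    intro x y a
    have := hact.module.act_act x y (α.symm (α.symm a))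
    simpa only [LinearMap.comp_apply, LinearEquiv.coe_coe, E.map_act, E.map_mul, hβ,
      LinearEquiv.apply_symm_apply] using this
  case one_act => exact fun a => α.injective (hact.module.one_act a)
  case act_mul =>
    intro h a b
    have := hact.act_mul (β h) (α.symm (α.symm a)) (α.symm (α.symm b))
    simpa (disch := fun_prop) only [tensorAct_tmul, sweedler_tmul, LinearMap.comp_apply,
      LinearEquiv.coe_coe, E.map_comul, sweedler_map, map_sweedler, map_sweedler_equiv, E.map_act,
      E.map_mulA, hβ, β2, LinearEquiv.apply_symm_apply] using this
  case act_one =>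
    intro h
    apply α.injective
    simpa only [map_smul, E.map_oneA, LinearMap.comp_apply, LinearEquiv.coe_coe]
      using hact.act_one h
  case coassocA =>
    intro a
    have := congrArg (fun T => sweedler T fun x r => sweedler r fun y z =>
      α.symm x ⊗ₜ[K] (α.symm y ⊗ₜ[K] α.symm z)) (hcoact.coalgebra.hom_coassoc (α.symm a))
    simpa (disch := fun_prop) only [sweedler_map, map_eq_sweedler, map_sweedler_equiv,
      sweedler_assoc_tmul, sweedler_sweedler, sweedler_tmul, LinearEquiv.coe_coe,
      LinearEquiv.apply_symm_apply, LinearEquiv.symm_apply_apply, LinearMap.comp_apply,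
      E.map_comulA] using this
  case counitA_left =>
    intro a
    simpa only [rTensor_eq_sweedler, map_sweedler_equiv, TensorProduct.lid_tmul,
      LinearMap.comp_apply, LinearEquiv.coe_coe, LinearEquiv.apply_symm_apply]
      using hcoact.coalgebra.counit_left (α.symm a)
  case counitA_right =>
    intro a
    simpa only [lTensor_eq_sweedler, map_sweedler_equiv, TensorProduct.rid_tmul,
      LinearMap.comp_apply, LinearEquiv.coe_coe, LinearEquiv.apply_symm_apply]
      using hcoact.coalgebra.counit_right (α.symm a)
  case coact_coact =>
    intro a
    have := congrArg (fun T => sweedler T fun x r => sweedler r fun y z =>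
      β.symm x ⊗ₜ[K] (β.symm y ⊗ₜ[K] α.symm z)) (hcoact.comodule.coact_coact (α.symm a))
    simpa (disch := fun_prop) only [sweedler_map, map_eq_sweedler, map_sweedler_equiv,
      sweedler_assoc_tmul, sweedler_sweedler, sweedler_tmul, LinearEquiv.coe_coe,
      LinearEquiv.apply_symm_apply, LinearEquiv.symm_apply_apply, LinearMap.comp_apply,
      E.map_comul, E.map_coact] using this
  case counit_coact =>
    intro a
    simpa only [rTensor_eq_sweedler, map_sweedler_equiv, TensorProduct.lid_tmul,
      LinearMap.comp_apply, LinearEquiv.coe_coe, LinearEquiv.apply_symm_apply]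
      using hcoact.comodule.counit_coact (α.symm a)
  case coact_comul =>
    intro a
    have := congrArg (fun T => sweedler T fun x r => sweedler r fun y z =>
      x ⊗ₜ[K] (α.symm y ⊗ₜ[K] α.symm z)) (hcoact.coact_comul (α.symm a))
    simpa (disch := fun_prop) only [sweedler_map, map_eq_sweedler, codiagonal_eq_sweedler,
      sweedler_sweedler, sweedler_tmul, LinearEquiv.coe_coe,
      LinearEquiv.apply_symm_apply, LinearEquiv.symm_apply_apply, LinearMap.comp_apply,
      E.map_comulA, E.map_coact, E.map_mul, hβ, β2] using this
  case coact_counit =>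
    intro a
    have hα : counitA (α.symm a) = counitA a := by
      rw [← E.map_counitA, LinearEquiv.apply_symm_apply]
    simpa only [lTensor_eq_sweedler, map_sweedler_equiv, TensorProduct.rid_tmul,
      LinearMap.comp_apply, LinearEquiv.coe_coe, LinearEquiv.apply_symm_apply, hα]
      using hcoact.coact_counit (α.symm a)


local notation "μ" => smashMul (LinearEquiv.refl K H) mul comul (LinearEquiv.refl K A) mulA act
local notation "δ" =>
  smashComul (LinearEquiv.refl K H) mul comul (LinearEquiv.refl K A) comulA coact
local notation "γ" => TensorProduct.congr α β

omit E in
theorem symm_apply_of_involutive (h : H) : β.symm h = β h := by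
  rw [LinearEquiv.symm_apply_eq, hβ]

/-- The Radford biproduct of the twisted maps is the ordinary one twisted by `α ⊗ β`. -/
theorem isRadfordBiproduct_twist_iff :
    IsRadfordBiproduct β mul' one comul' counit α mulA' oneA comulA' counitA act' coact' ↔
      IsHomBialgebra (LinearEquiv.refl K (A ⊗[K] H)) μ (oneA ⊗ₜ[K] one) δ
        (tensorCounit counitA counit) := by
  have hs := symm_apply_of_involutive hβ
  have hm : smashMul β mul' comul' α mulA' act' = (γ).toLinearMap ∘ₗ μ := by
    ext a h b g
    simp (disch := fun_prop) only [TensorProduct.AlgebraTensorModule.curry_apply,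
      LinearMap.restrictScalars_self, TensorProduct.curry_apply, LinearMap.comp_apply,
      LinearEquiv.coe_coe, smashMul_tmul, LinearEquiv.refl_symm,
      LinearEquiv.refl_apply, E.map_comul, sweedler_map,
      map_sweedler_equiv, TensorProduct.congr_tmul, E.map_mulA, E.map_act, E.map_mul, hs, hβ,
      LinearEquiv.apply_symm_apply]
  have hd : smashComul β mul' comul' α comulA' coact' = δ ∘ₗ (γ).toLinearMap := by
    ext a h
    simp (disch := fun_prop) only [TensorProduct.AlgebraTensorModule.curry_apply,
      LinearMap.restrictScalars_self, TensorProduct.curry_apply, LinearMap.comp_apply,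
      LinearEquiv.coe_coe, smashComul_tmul, LinearEquiv.refl_symm,
      LinearEquiv.refl_apply, E.map_comul, E.map_comulA,
      E.map_coact, sweedler_map, TensorProduct.congr_tmul, E.map_mul, hs, hβ,
      LinearEquiv.symm_apply_apply]
  rw [IsRadfordBiproduct, hm, hd]
  refine isHomBialgebra_twist_iff (fun x y => ?_) ?_ (fun x => ?_) (fun x => ?_)
  · revert x; refine eq_of_tmul (by fun_prop) (by fun_prop) fun a h => ?_
    revert y; refine eq_of_tmul (by fun_prop) (by fun_prop) fun b g => ?_
    simp (disch := fun_prop) only [smashMul_refl_tmul, E.map_comul, sweedler_map,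
      map_sweedler_equiv, TensorProduct.congr_tmul, E.map_mulA, E.map_act, E.map_mul,
      LinearEquiv.coe_coe]
  · rw [TensorProduct.congr_tmul, E.map_one, E.map_oneA]
  · revert x; refine eq_of_tmul (by fun_prop) (by fun_prop) fun a h => ?_
    simp (disch := fun_prop) only [smashComul_refl_tmul, E.map_comul, E.map_comulA, E.map_coact,
      sweedler_map, map_sweedler, TensorProduct.map_tmul, TensorProduct.congr_tmul, E.map_mul,
      LinearEquiv.coe_coe]
  · revert x; refine eq_of_tmul (by fun_prop) (by fun_prop) fun a h => ?_
    simp only [TensorProduct.congr_tmul, tensorCounit_tmul, E.map_counit, E.map_counitA]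

/-- For twisted maps, the axioms of a bialgebra in Hom-Yetter-Drinfeld modules that do not already
belong to a module Hom-algebra and comodule Hom-coalgebra are the ordinary ones, up to
automorphisms. -/
theorem isBialgebraInHomYD_twist_iff
    (hact : IsModuleHomAlgebra β mul' one comul' counit α mulA' oneA act')
    (hcoact : IsComoduleHomCoalgebra β mul' one comul' counit α comulA' counitA coact') :
    IsBialgebraInHomYD β mul' one comul' counit α mulA' oneA comulA' counitA act' coact' ↔
      IsBraidedBialgebra mul one comul counit mulA oneA comulA counitA act coact := by
  have hβ2 : β ^ 2 = LinearEquiv.refl K H := by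
    ext x
    rw [pow_two]
    exact hβ x
  have hβ3 (x : H) : (β ^ 3) x = β x := by
    rw [pow_succ, hβ2]
    rfl
  have compat_iff : (∀ (h : H) (m : A),
      TensorProduct.map mul' act' (TensorProduct.tensorTensorTensorComm K H H H A
          ((β ^ 3).toLinearMap.lTensor H (comul' h) ⊗ₜ[K] β.toLinearMap.rTensor A (coact' m))) =
        (mul').rTensor A (TensorProduct.rightComm K H A H (LinearMap.rTensor H
          (coact' ∘ₗ act' ∘ₗ (TensorProduct.mk K H A).flip m ∘ₗ (β ^ 2).toLinearMap)
            (comul' h)))) ↔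
      ∀ h a, (sweedler (comul h) fun h₁ h₂ => sweedler (coact a) fun x y =>
        mul (h₁ ⊗ₜ x) ⊗ₜ[K] act (h₂ ⊗ₜ y)) =
      sweedler (comul h) fun h₁ h₂ => sweedler (coact (act (h₁ ⊗ₜ a))) fun x y =>
        mul (x ⊗ₜ h₂) ⊗ₜ[K] y := by
    let e := TensorProduct.congr β (LinearEquiv.refl K A)
    have hl (h : H) (m : A) :
        TensorProduct.map mul' act' (TensorProduct.tensorTensorTensorComm K H H H A
          ((β ^ 3).toLinearMap.lTensor H (comul' h) ⊗ₜ[K] β.toLinearMap.rTensor A (coact' m))) =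
        e (sweedler (comul (β h)) fun h₁ h₂ => sweedler (coact (α (α m))) fun x y =>
          mul (h₁ ⊗ₜ x) ⊗ₜ[K] act (h₂ ⊗ₜ y)) := by
      simp (disch := fun_prop) only [map_tensorTensorTensorComm_eq_sweedler, e,
        LinearMap.comp_apply, LinearEquiv.coe_coe, E.map_comul, E.map_coact, sweedler_map,
        map_sweedler_equiv, TensorProduct.congr_tmul, E.map_mul, E.map_act, hβ, hβ3, LinearEquiv.refl_apply]
    have hr (h : H) (m : A) :
        (mul').rTensor A (TensorProduct.rightComm K H A H (LinearMap.rTensor H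
          (coact' ∘ₗ act' ∘ₗ (TensorProduct.mk K H A).flip m ∘ₗ (β ^ 2).toLinearMap)
            (comul' h))) =
        e (sweedler (comul (β h)) fun h₁ h₂ => sweedler (coact (act (h₁ ⊗ₜ α (α m)))) fun x y =>
          mul (x ⊗ₜ h₂) ⊗ₜ[K] y) := by
      simp (disch := fun_prop) only [rTensor_rightComm_eq_sweedler, e, LinearMap.comp_apply,
        LinearEquiv.coe_coe, E.map_comul, sweedler_map, map_sweedler_equiv,
        TensorProduct.congr_tmul, E.map_mul, E.map_act, hβ, hβ2, LinearEquiv.refl_apply,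
        LinearMap.flip_apply, TensorProduct.mk_apply]
    simp only [hl, hr, e.injective.eq_iff]
    refine ⟨fun hc h a => ?_, fun hc h m => hc _ _⟩
    simpa only [hβ, LinearEquiv.apply_symm_apply] using hc (β h) (α.symm (α.symm a))
  have coact_mul_iff : (∀ t : A ⊗[K] A, coact' (mulA' t) =
        (mulA').lTensor H (tensorCoact β mul' coact' coact' t)) ↔
      ∀ a b, coact (mulA (a ⊗ₜ b)) = sweedler (coact a) fun x₁ y₁ => sweedler (coact b)
        fun x₂ y₂ => mul (x₁ ⊗ₜ x₂) ⊗ₜ[K] mulA (y₁ ⊗ₜ y₂) := by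
    let e := TensorProduct.congr (LinearEquiv.refl K H) (α ≪≫ₗ α)
    have hl (a b : A) : coact' (mulA' (a ⊗ₜ b)) = e (coact (mulA (a ⊗ₜ b))) := by
      simp only [LinearMap.comp_apply, LinearEquiv.coe_coe, E.map_coact]
      generalize coact (mulA (a ⊗ₜ b)) = t
      revert t; refine eq_of_tmul (by fun_prop) (by fun_prop) fun x y => ?_
      simp only [e, TensorProduct.map_tmul, TensorProduct.congr_tmul, LinearEquiv.coe_coe, hβ,
        LinearEquiv.refl_apply, LinearEquiv.trans_apply]
    have hr (a b : A) : (mulA').lTensor H (tensorCoact β mul' coact' coact' (a ⊗ₜ b)) =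
        e (sweedler (coact a) fun x₁ y₁ => sweedler (coact b)
          fun x₂ y₂ => mul (x₁ ⊗ₜ x₂) ⊗ₜ[K] mulA (y₁ ⊗ₜ y₂)) := by
      simp (disch := fun_prop) only [e, tensorCoact, hβ2, lTensor_eq_sweedler, rTensor_eq_sweedler,
        codiagonal_eq_sweedler, LinearMap.comp_apply, LinearEquiv.coe_coe, LinearEquiv.refl_symm,
        LinearEquiv.refl_apply, sweedler_sweedler, sweedler_tmul, E.map_coact, sweedler_map,
        E.map_mul, E.map_mulA, hβ, map_sweedler_equiv, TensorProduct.congr_tmul,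
        LinearEquiv.trans_apply]
    refine ⟨fun hc a b => e.injective ?_, fun hc => ?_⟩
    · rw [← hl, ← hr, hc]
    · refine eq_of_tmul (by fun_prop) (by fun_prop) fun a b => ?_
      rw [hl, hr, hc]
  have comul_act_iff : (∀ (h : H) (a : A), comulA' (act' (h ⊗ₜ a)) =
        tensorAct comul' act' act' (h ⊗ₜ comulA' a)) ↔
      ∀ h a, comulA (act (h ⊗ₜ a)) = sweedler (comul h) fun x y => sweedler (comulA a)
        fun a₁ a₂ => act (x ⊗ₜ a₁) ⊗ₜ[K] act (y ⊗ₜ a₂) := by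
    let e := TensorProduct.congr (α ≪≫ₗ α) (α ≪≫ₗ α)
    have hl (h : H) (a : A) : comulA' (act' (h ⊗ₜ a)) = e (comulA (act (h ⊗ₜ a))) := by
      simp only [LinearMap.comp_apply, LinearEquiv.coe_coe, E.map_comulA]
      generalize comulA (act (h ⊗ₜ a)) = t
      revert t; exact eq_of_tmul (by fun_prop) (by fun_prop) fun _ _ => rfl
    have hr (h : H) (a : A) : tensorAct comul' act' act' (h ⊗ₜ comulA' a) =
        e (sweedler (comul h) fun x y => sweedler (comulA a)
          fun a₁ a₂ => act (x ⊗ₜ a₁) ⊗ₜ[K] act (y ⊗ₜ a₂)) := by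
      simp (disch := fun_prop) only [e, tensorAct_tmul, LinearMap.comp_apply, LinearEquiv.coe_coe,
        E.map_comul, E.map_comulA, sweedler_map, E.map_act, hβ, map_sweedler_equiv,
        TensorProduct.congr_tmul, LinearEquiv.trans_apply]
    simp only [hl, hr, e.injective.eq_iff]
  have comul_mul_iff : (∀ a b : A, comulA' (mulA' (a ⊗ₜ b)) =
        braidedMul β α mulA' act' coact' (comulA' a ⊗ₜ comulA' b)) ↔
      ∀ a b, comulA (mulA (a ⊗ₜ b)) = sweedler (comulA a) fun a₁ a₂ => sweedler (coact a₂)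
        fun x y => sweedler (comulA b) fun b₁ b₂ =>
          mulA (a₁ ⊗ₜ act (x ⊗ₜ b₁)) ⊗ₜ[K] mulA (y ⊗ₜ b₂) := by
    let e := TensorProduct.congr (α ≪≫ₗ α) (α ≪≫ₗ α)
    have hl (a b : A) : comulA' (mulA' (a ⊗ₜ b)) = e (comulA (mulA (a ⊗ₜ b))) := by
      simp only [LinearMap.comp_apply, LinearEquiv.coe_coe, E.map_comulA]
      generalize comulA (mulA (a ⊗ₜ b)) = t
      revert t; exact eq_of_tmul (by fun_prop) (by fun_prop) fun _ _ => rfl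
    have hr (a b : A) : braidedMul β α mulA' act' coact' (comulA' a ⊗ₜ comulA' b) =
        e (sweedler (comulA a) fun a₁ a₂ => sweedler (coact a₂)
          fun x y => sweedler (comulA b) fun b₁ b₂ =>
            mulA (a₁ ⊗ₜ act (x ⊗ₜ b₁)) ⊗ₜ[K] mulA (y ⊗ₜ b₂)) := by
      simp (disch := fun_prop) only [e, braidedMul_eq_sweedler, LinearMap.comp_apply,
        LinearEquiv.coe_coe, E.map_coact, E.map_comulA, sweedler_map, E.map_act, E.map_mulA, hβ,
        map_sweedler_equiv, TensorProduct.congr_tmul, LinearEquiv.trans_apply,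
        LinearEquiv.apply_symm_apply]
      simp only [sweedler_comm (coact _) (comulA _)]
    simp only [hl, hr, e.injective.eq_iff]
  constructor
  · intro B
    refine ⟨comul_mul_iff.1 B.comul_mul, ?_, fun a b => ?_, B.counit_one,
      coact_mul_iff.1 B.mul_morphism.map_coact, ?_, comul_act_iff.1 B.comul_morphism.map_act,
      fun h a => ?_, compat_iff.1 B.object.compat⟩
    · simpa only [LinearMap.comp_apply, LinearEquiv.coe_coe, E.map_oneA] using B.comul_one
    · simpa only [LinearMap.comp_apply, LinearEquiv.coe_coe, E.map_counitA] using B.counit_mul a b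
    · simpa [unitCoact, E.map_oneA] using B.unit_morphism.map_coact 1
    · simpa [unitAct, E.map_counitA] using B.counit_morphism.map_act h a
  · intro P
    refine ⟨⟨hact.module, hcoact.comodule, compat_iff.2 P.compat⟩, hact.algebra,
      hcoact.coalgebra, ⟨?_, fun h t => ?_, coact_mul_iff.2 P.coact_mul⟩,
      ⟨?_, fun h k => ?_, fun k => ?_⟩,
      ⟨hcoact.coalgebra.comul_map, comul_act_iff.2 P.comul_act, fun a => ?_⟩,
      ⟨hcoact.coalgebra.counit_map, fun h a => ?_, fun a => ?_⟩,
      comul_mul_iff.2 P.comul_mul, ?_, fun a b => ?_, P.counit_one⟩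
    · refine eq_of_tmul (by fun_prop) (by fun_prop) fun a b => ?_
      exact (hact.algebra.map_mul a b).symm
    -- `μ_A` is `H`-linear because `β²(h) = h` in the module Hom-algebra axiom.
    · revert t; refine eq_of_tmul (by fun_prop) (by fun_prop) fun a b => ?_
      rw [← hact.act_mul, hβ2, LinearEquiv.refl_apply]
    · simp [E.map_oneA]
    · have := hact.act_one h
      simp only [unitAct, LinearMap.comp_apply, LinearEquiv.coe_coe, LinearMap.rTensor_tmul,
        TensorProduct.lid_tmul, LinearMap.toSpanSingleton_apply, TensorProduct.tmul_smul,
        map_smul] at this ⊢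
      rw [this, smul_comm]
    · simp [unitCoact, E.map_oneA, P.coact_one]
    · rw [tensorCoact, hβ2, LinearMap.comp_apply, ← hcoact.coact_comul, hβ2]
      rw [LinearEquiv.refl_symm, LinearEquiv.refl_toLinearMap, LinearMap.rTensor_id]
      rfl
    · simp [unitAct, E.map_counitA, P.counit_act]
    · apply (TensorProduct.rid K H).injective
      rw [hcoact.coact_counit]
      simp [unitCoact]
    · simpa only [LinearMap.comp_apply, LinearEquiv.coe_coe, E.map_oneA] using P.comul_one
    · simpa only [LinearMap.comp_apply, LinearEquiv.coe_coe, E.map_counitA] using P.counit_mul a b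

end Untwisting

end HomBiproduct

theorem theorem4p8 {K : Type*} [Field K]
    {H : Type*} [AddCommGroup H] [Module K H]
    {A : Type*} [AddCommGroup A] [Module K A]
    (β : H ≃ₗ[K] H) (mulH : H ⊗[K] H →ₗ[K] H) (oneH : H)
    (comulH : H →ₗ[K] H ⊗[K] H) (counitH : H →ₗ[K] K) (S : H →ₗ[K] H)
    (hH : HomBiproduct.IsHomHopfAlgebra β mulH oneH comulH counitH S)
    (hS : Function.Bijective S)
    (hβ : ∀ h : H, β (β h) = h)
    (α : A ≃ₗ[K] A) (mulA : A ⊗[K] A →ₗ[K] A) (oneA : A)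
    (comulA : A →ₗ[K] A ⊗[K] A) (counitA : A →ₗ[K] K)
    (act : H ⊗[K] A →ₗ[K] A) (coact : A →ₗ[K] H ⊗[K] A)
    (hact : HomBiproduct.IsModuleHomAlgebra β mulH oneH comulH counitH α mulA oneA act)
    (hcoact : HomBiproduct.IsComoduleHomCoalgebra β mulH oneH comulH counitH
      α comulA counitA coact) :
    HomBiproduct.IsRadfordBiproduct β mulH oneH comulH counitH
        α mulA oneA comulA counitA act coact ↔
      HomBiproduct.IsBialgebraInHomYD β mulH oneH comulH counitH
        α mulA oneA comulA counitA act coact := by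
  -- Every structure map is the twist of an ordinary one.
  obtain ⟨mulH, rfl⟩ : ∃ m, mulH = β.toLinearMap ∘ₗ m :=
    ⟨β.symm.toLinearMap ∘ₗ mulH, by ext; simp⟩
  obtain ⟨comulH, rfl⟩ : ∃ d, comulH = d ∘ₗ β.toLinearMap :=
    ⟨comulH ∘ₗ β.symm.toLinearMap, by ext; simp⟩
  obtain ⟨mulA, rfl⟩ : ∃ m, mulA = α.toLinearMap ∘ₗ m :=
    ⟨α.symm.toLinearMap ∘ₗ mulA, by ext; simp⟩
  obtain ⟨comulA, rfl⟩ : ∃ d, comulA = d ∘ₗ α.toLinearMap :=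
    ⟨comulA ∘ₗ α.symm.toLinearMap, by ext; simp⟩
  obtain ⟨act, rfl⟩ : ∃ m, act = α.toLinearMap ∘ₗ m :=
    ⟨α.symm.toLinearMap ∘ₗ act, by ext; simp⟩
  obtain ⟨coact, rfl⟩ : ∃ d, coact = d ∘ₗ α.toLinearMap :=
    ⟨coact ∘ₗ α.symm.toLinearMap, by ext; simp⟩
  have E := HomBiproduct.isAutomorphismPair_of_twist hH.bialgebra hact hcoact
  have D := HomBiproduct.isBiproductDatum_of_twist E hβ hH.bialgebra hact hcoact
  rw [HomBiproduct.isRadfordBiproduct_twist_iff E hβ,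
    HomBiproduct.isBialgebraInHomYD_twist_iff E hβ hact hcoact]
  exact ⟨D.isBraidedBialgebra_of_smash, D.isHomBialgebra_smash⟩
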